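/- There is a randomized word-RAM algorithm with the following property. It takes as input a finite simple undirected graph $G$ with $n$ vertices and $m$ edges, given by adjacency lists, and a rational number $c \ge 1$, given by its numerator and denominator, such that $\pi_G(k) \le c\cdot k$ for all integers $k \ge 1$. Here $N(v)$ is the set of neighbors of $v$, and the neighborhood complexity is $\pi_G(k) = \max_{A \subseteq V(G),\, |A| \le k} |\{N(v) \cap A : v \in V(G)\}|$. On every such input and for every outcome of its random choices, the algorithm halts within $\mathcal{O}((n+m)\log n)$ steps (and within $\mathcal{O}(1)$ steps if $n \le 1$), where the constant in the $\mathcal{O}$-notation depends neither on $G$ nor on $c$; and with probability at least $2/3$ it outputs a total order on $V(G)$ with crossing number at most $12c^2\log^2 n$. Logarithms are to base $2$. The crossing number of a total order on $V(G)$ is the maximum, over all $v \in V(G)$, of the number of pairs $(u,u')$ of consecutive elements of the order such that exactly one of $u$ and $u'$ belongs to $N(v)$. The word-RAM performs arithmetic and comparisons on words, memory accesses, and uniform random choices from $\{0,\dots,k-1\}$ for a word $k$, each in one step; its word size is any number of bits that is at least a fixed constant times the bit length of $n+m+p+q$, where $c=p/q$ in lowest terms. -/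

import Mathlib

/-! ## Set systems, shatter functions, crossing numbers -/

section Combinatorics

/-- The shatter function of the set system `(V, F)`: the maximum, over all `A ⊆ V` with at most
`k` elements, of the number of distinct traces `X ∩ A` with `X ∈ F`. -/
noncomputable def shatterFunction {V : Type*} [Fintype V] [DecidableEq V]
    (F : Finset (Finset V)) (k : ℕ) : ℕ :=
  (Finset.univ.filter fun A : Finset V => A.card ≤ k).sup
    fun A => (F.image fun X => X ∩ A).card

open scoped Classical in
/-- The family `{N(v) | v ∈ V(G)}` of all (open) neighborhoods of the graph `G`. -/
noncomputable def neighborhoodFamily {V : Type*} [Fintype V] [DecidableEq V]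
    (G : SimpleGraph V) : Finset (Finset V) :=
  Finset.univ.image fun v => Finset.univ.filter fun u => G.Adj v u

/-- The neighborhood complexity of `G`. -/
noncomputable def neighborhoodComplexity {V : Type*} [Fintype V] [DecidableEq V]
    (G : SimpleGraph V) (k : ℕ) : ℕ :=
  shatterFunction (neighborhoodFamily G) k

open scoped Classical in
/-- The crossing number of the total order `L` on `V` with respect to `X`: the number of pairs
`(u, v)` such that `v` is the immediate successor of `u` and exactly one of them is in `X`. -/
noncomputable def crossings {V : Type*} [Fintype V] (L : LinearOrder V) (X : Finset V) : ℕ :=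
  (Finset.univ.filter fun p : V × V =>
    (L.lt p.1 p.2 ∧ ∀ z, ¬ (L.lt p.1 z ∧ L.lt z p.2)) ∧ ¬ (p.1 ∈ X ↔ p.2 ∈ X)).card

/-- The crossing number of the total order `L` with respect to the set system `(V, F)`. -/
noncomputable def crossingNumber {V : Type*} [Fintype V] (L : LinearOrder V)
    (F : Finset (Finset V)) : ℕ :=
  F.sup fun X => crossings L X

/-- The crossing number of a total order on `V(G)` with respect to the graph `G`. -/
noncomputable def graphCrossingNumber {V : Type*} [Fintype V] [DecidableEq V]
    (L : LinearOrder V) (G : SimpleGraph V) : ℕ :=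
  crossingNumber L (neighborhoodFamily G)

end Combinatorics

/-! ## A randomized word RAM

The machine has registers and finitely many (per program) memory banks, all of whose cells hold
natural numbers; arithmetic is modulo `2 ^ w`, where `w` is the word size. Programs are built
from assignments, stores, random choices, conditionals and while loops. A program is a fixed
finite object, so all its expressions have constant size, and every elementary step of the
operational semantics below is counted as one unit of time. -/

namespace WordRAM

/-- Arithmetic and comparison instructions. -/
inductive Op : Type
  | add | sub | mul | div | mod | lt | eq

/-- The result of an instruction with word size `w`. Subtraction is truncated at `0`. -/
def Op.eval (w : ℕ) : Op → ℕ → ℕ → ℕ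
  | .add, a, b => (a + b) % 2 ^ w
  | .sub, a, b => a - b
  | .mul, a, b => (a * b) % 2 ^ w
  | .div, a, b => a / b
  | .mod, a, b => a % b
  | .lt, a, b => if a < b then 1 % 2 ^ w else 0
  | .eq, a, b => if a = b then 1 % 2 ^ w else 0

/-- Expressions: literals, registers, memory reads `bank[address]`, and instructions. -/
inductive Exp : Type
  | lit (k : ℕ)
  | reg (r : ℕ)
  | read (bank : ℕ) (address : Exp)
  | bin (o : Op) (e f : Exp)

/-- Contents of the registers and of the memory banks. -/
structure Store : Type where
  reg : ℕ → ℕ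
  mem : ℕ → ℕ → ℕ

/-- Write `x` to register `r`. -/
def Store.setReg (σ : Store) (r x : ℕ) : Store where
  reg := Function.update σ.reg r x
  mem := σ.mem

/-- Write `x` to the cell with address `a` of memory bank `b`. -/
def Store.setMem (σ : Store) (b a x : ℕ) : Store where
  reg := σ.reg
  mem := Function.update σ.mem b (Function.update (σ.mem b) a x)

/-- The value of an expression. -/
def Exp.eval (w : ℕ) (σ : Store) : Exp → ℕ
  | .lit k => k % 2 ^ w
  | .reg r => σ.reg r
  | .read b e => σ.mem b (e.eval w σ)
  | .bin o e f => o.eval w (e.eval w σ) (f.eval w σ)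

/-- Programs. -/
inductive Prog : Type
  /-- Do nothing. -/
  | skip
  /-- `r := e` -/
  | assign (r : ℕ) (e : Exp)
  /-- `bank[address] := e` -/
  | store (bank : ℕ) (address e : Exp)
  /-- `r :=` a uniformly random element of `{0, …, e - 1}` (and `r := 0` if `e = 0`) -/
  | rand (r : ℕ) (e : Exp)
  /-- First `p`, then `q`. -/
  | seq (p q : Prog)
  /-- If `e ≠ 0` then `p` else `q`. -/
  | cond (e : Exp) (p q : Prog)
  /-- While `e ≠ 0` do `p`. -/
  | loop (e : Exp) (p : Prog)

/-- A configuration: the programs that remain to be executed, in this order, and the store. -/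
structure Config : Type where
  todo : List Prog
  store : Store

/-- A configuration is halting if nothing remains to be executed. -/
def Config.Halted (C : Config) : Prop := C.todo = []

/-- The uniform distribution on `{0, …, k - 1}`, and the point mass at `0` if `k = 0`. -/
noncomputable def uniformBelow : ℕ → PMF ℕ
  | 0 => PMF.pure 0
  | k + 1 => (PMF.uniformOfFintype (Fin (k + 1))).map Fin.val

/-- One step of the machine with word size `w`; the next configuration is random. Halting
configurations do not change any more. -/
noncomputable def step (w : ℕ) : Config → PMF Config
  | ⟨[], σ⟩ => PMF.pure ⟨[], σ⟩
  | ⟨.skip :: l, σ⟩ => PMF.pure ⟨l, σ⟩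
  | ⟨.assign r e :: l, σ⟩ => PMF.pure ⟨l, σ.setReg r (e.eval w σ)⟩
  | ⟨.store b a e :: l, σ⟩ => PMF.pure ⟨l, σ.setMem b (a.eval w σ) (e.eval w σ)⟩
  | ⟨.rand r e :: l, σ⟩ => (uniformBelow (e.eval w σ)).map fun x => ⟨l, σ.setReg r x⟩
  | ⟨.seq p q :: l, σ⟩ => PMF.pure ⟨p :: q :: l, σ⟩
  | ⟨.cond e p q :: l, σ⟩ => PMF.pure (if e.eval w σ ≠ 0 then ⟨p :: l, σ⟩ else ⟨q :: l, σ⟩)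
  | ⟨.loop e p :: l, σ⟩ =>
      PMF.pure (if e.eval w σ ≠ 0 then ⟨p :: .loop e p :: l, σ⟩ else ⟨l, σ⟩)

/-- The distribution of the configuration after `t` steps. -/
noncomputable def run (w : ℕ) : ℕ → Config → PMF Config
  | 0, C => PMF.pure C
  | t + 1, C => (step w C).bind (run w t)

end WordRAM

/-! ## Input and output -/

/-- `adj` is an adjacency list representation of `G`: for each vertex, a list of its neighbors
without repetitions, in an arbitrary order. -/
def IsAdjacencyList {n : ℕ} (G : SimpleGraph (Fin n)) (adj : Fin n → List (Fin n)) : Prop :=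
  ∀ v, (adj v).Nodup ∧ ∀ u, u ∈ adj v ↔ G.Adj v u

/-- The input for a graph with vertices `0, …, n - 1`, given by adjacency lists, and a positive
rational number `c`. Registers `0`, `1`, `2` hold `n` and the numerator and denominator of `c`.
Memory bank `1` holds the concatenation of the lists of the vertices `0, …, n - 1`, and cell `i`
of bank `0`, for `i ≤ n`, holds the total length of the lists of the vertices `u < i`. All other
cells are `0`. -/
def graphInput {n : ℕ} (adj : Fin n → List (Fin n)) (c : ℚ) : WordRAM.Store where
  reg := fun r => match r with
    | 0 => n
    | 1 => c.num.toNat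
    | 2 => c.den
    | _ => 0
  mem := fun b i => match b with
    | 0 => if i ≤ n then ∑ u : Fin n with u.val < i, (adj u).length else 0
    | 1 => ((List.ofFn adj).flatten.map Fin.val).getD i 0
    | _ => 0

/-- The output in `σ` is the total order `L` on the vertices `0, …, n - 1`: the first `n` cells of
memory bank `2` list all vertices in increasing order with respect to `L`. -/
def OutputsOrder {n : ℕ} (σ : WordRAM.Store) (L : LinearOrder (Fin n)) : Prop :=
  ∃ s : Fin n ≃ Fin n, (∀ i : Fin n, σ.mem 2 i.val = (s i).val) ∧
    ∀ i j : Fin n, i.val < j.val → L.lt (s i) (s j)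

/-! The order arises by coarsening a partition of the vertices into blocks, each with a
representative. A round with sample size `k` draws `k` representatives at random (with replacement);
call the drawn set `A`. It picks one vertex for every trace on `A`, which gives a set `B` of at most
`c * k` vertices, and merges the blocks whose representatives have the same trace on `B`. At most `c
* |B| ≤ c ^ 2 * k` blocks remain (`mergeTwins_spec`). Then `k` is halved, so every round starts with
at most `2 * c ^ 2 * k` blocks, and after `Nat.clog 2 n` rounds at most `c ^ 2` blocks are left.
These are concatenated.

The crossings are counted backwards, from coarse to fine blocks, for a numbering in which all blocks
are intervals. Suppose that every set of at least `δ` representatives that distinguishes two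
vertices is hit by the sample. Then a vertex `v` and the vertex `v'` of `B` with the same trace on
`A` are distinguished by fewer than `δ` representatives. An interval is entered and left at most
once, so exchanging `v` for `v'` costs at most `2 * δ` crossings (`Blocks.blockCrossings_le_add`).
For `v'` itself the old and the new representative of a vertex are twins, so the merge does not
affect its crossings. Hence a round costs `2 * δ` (`Budget.merge`), and the last blocks contribute
at most `2 * c ^ 2`.

A fixed distinguishing set is missed with probability at most `exp (-δ / (2 * c ^ 2))`
(`avg_exists_avoid_le`). A union bound over `n ^ 2` pairs and all rounds, with `δ = 6 * c ^ 2 * log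
n` (natural logarithm), yields both the failure probability and the constant 12 if `n ≥ 16`; for
smaller `n` the trivial bound `n - 1` on the crossings is good enough (`exists_parameter`).

A round takes linear time: traces are computed by partition refinement, where a marked vertex costs
only its degree (`split_spec`, `partition_spec`), and offsets inside merged blocks are prefix sums
(`merge_spec`). Deterministic code is treated with `Terminates`, and random code with `Safe`, which
bounds time and failure probability together. -/

/-! ## A program logic for the word RAM -/

namespace WordRAM

/-- Whether the program can write to register `s`. -/
def Prog.writesReg : Prog → ℕ → Bool
  | .skip, _ => false
  | .assign r _, s => r == s
  | .store _ _ _, _ => false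
  | .rand r _, s => r == s
  | .seq p q, s => p.writesReg s || q.writesReg s
  | .cond _ p q, s => p.writesReg s || q.writesReg s
  | .loop _ p, s => p.writesReg s

/-- Whether the program can write to memory bank `s`. -/
def Prog.writesMem : Prog → ℕ → Bool
  | .skip, _ => false
  | .assign _ _, _ => false
  | .store b _ _, s => b == s
  | .rand _ _, _ => false
  | .seq p q, s => p.writesMem s || q.writesMem s
  | .cond _ p q, s => p.writesMem s || q.writesMem s
  | .loop _ p, s => p.writesMem s

/-- The stores `σ` and `τ` agree on everything that `p` cannot write. -/
structure Unchanged (p : Prog) (σ τ : Store) : Prop where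
  reg : ∀ r, p.writesReg r = false → τ.reg r = σ.reg r
  mem : ∀ b, p.writesMem b = false → τ.mem b = σ.mem b

theorem Unchanged.refl (p : Prog) (σ : Store) : Unchanged p σ σ :=
  ⟨fun _ _ => rfl, fun _ _ => rfl⟩

theorem Unchanged.trans {p : Prog} {σ τ υ : Store} (h : Unchanged p σ τ)
    (h' : Unchanged p τ υ) : Unchanged p σ υ :=
  ⟨fun r hr => (h'.reg r hr).trans (h.reg r hr), fun b hb => (h'.mem b hb).trans (h.mem b hb)⟩

theorem Unchanged.weaken {p q : Prog} {σ τ : Store} (h : Unchanged p σ τ)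
    (hr : ∀ r, q.writesReg r = false → p.writesReg r = false)
    (hm : ∀ b, q.writesMem b = false → p.writesMem b = false) : Unchanged q σ τ :=
  ⟨fun r h' => h.reg r (hr r h'), fun b h' => h.mem b (hm b h')⟩

theorem Unchanged.seq_left {p q : Prog} {σ τ : Store} (h : Unchanged p σ τ) :
    Unchanged (.seq p q) σ τ :=
  h.weaken (by simp +contextual [Prog.writesReg]) (by simp +contextual [Prog.writesMem])

theorem Unchanged.seq_right {p q : Prog} {σ τ : Store} (h : Unchanged q σ τ) :
    Unchanged (.seq p q) σ τ :=
  h.weaken (by simp +contextual [Prog.writesReg]) (by simp +contextual [Prog.writesMem])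

/-- `Terminates w p t σ Q`: started in `σ`, the program `p`, which makes no random choices,
halts within `t` steps in a store that satisfies `Q`. -/
inductive Terminates (w : ℕ) : Prog → ℕ → Store → (Store → Prop) → Prop
  | skip {σ : Store} {Q : Store → Prop} : Q σ → Terminates w .skip 1 σ Q
  | assign {r : ℕ} {e : Exp} {σ : Store} {Q : Store → Prop} :
      Q (σ.setReg r (e.eval w σ)) → Terminates w (.assign r e) 1 σ Q
  | store {b : ℕ} {a e : Exp} {σ : Store} {Q : Store → Prop} :
      Q (σ.setMem b (a.eval w σ) (e.eval w σ)) → Terminates w (.store b a e) 1 σ Q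
  | seq {p q : Prog} {t u : ℕ} {σ : Store} {Q R : Store → Prop} :
      Terminates w p t σ R → (∀ τ, R τ → Terminates w q u τ Q) →
      Terminates w (.seq p q) (t + u + 1) σ Q
  | cond_true {e : Exp} {p q : Prog} {t : ℕ} {σ : Store} {Q : Store → Prop} :
      e.eval w σ ≠ 0 → Terminates w p t σ Q → Terminates w (.cond e p q) (t + 1) σ Q
  | cond_false {e : Exp} {p q : Prog} {t : ℕ} {σ : Store} {Q : Store → Prop} :
      e.eval w σ = 0 → Terminates w q t σ Q → Terminates w (.cond e p q) (t + 1) σ Q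
  | loop_done {e : Exp} {p : Prog} {σ : Store} {Q : Store → Prop} :
      e.eval w σ = 0 → Q σ → Terminates w (.loop e p) 1 σ Q
  | loop_step {e : Exp} {p : Prog} {t u : ℕ} {σ : Store} {Q R : Store → Prop} :
      e.eval w σ ≠ 0 → Terminates w p t σ R → (∀ τ, R τ → Terminates w (.loop e p) u τ Q) →
      Terminates w (.loop e p) (t + u + 1) σ Q
  | weaken {p : Prog} {t u : ℕ} {σ : Store} {Q R : Store → Prop} :
      t ≤ u → (∀ τ, R τ → Q τ) → Terminates w p t σ R → Terminates w p u σ Q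

variable {w : ℕ}

theorem Terminates.mono {p : Prog} {t u : ℕ} {σ : Store} {Q R : Store → Prop}
    (h : Terminates w p t σ R) (htu : t ≤ u) (hQ : ∀ τ, R τ → Q τ) : Terminates w p u σ Q :=
  .weaken htu hQ h

/-- A program changes only what it writes. -/
theorem Terminates.frame {p : Prog} {t : ℕ} {σ : Store} {Q : Store → Prop}
    (h : Terminates w p t σ Q) : Terminates w p t σ (fun τ => Q τ ∧ Unchanged p σ τ) := by
  induction h with
  | skip h => exact .skip ⟨h, .refl _ _⟩
  | assign h =>
    refine .assign ⟨h, fun r hr => ?_, fun _ _ => rfl⟩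
    simp only [Prog.writesReg, beq_eq_false_iff_ne] at hr
    simp [Store.setReg, hr.symm]
  | store h =>
    refine .store ⟨h, fun _ _ => rfl, fun r hr => ?_⟩
    simp only [Prog.writesMem, beq_eq_false_iff_ne] at hr
    simp [Store.setMem, hr.symm]
  | seq _ _ ih ih' =>
    refine .seq ih fun τ hτ => (ih' τ hτ.1).mono le_rfl fun υ hυ => ⟨hυ.1, ?_⟩
    exact hτ.2.seq_left.trans hυ.2.seq_right
  | cond_true h _ ih =>
    exact .cond_true h (ih.mono le_rfl fun υ hυ => ⟨hυ.1, hυ.2.weaken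
      (by simp +contextual [Prog.writesReg]) (by simp +contextual [Prog.writesMem])⟩)
  | cond_false h _ ih =>
    exact .cond_false h (ih.mono le_rfl fun υ hυ => ⟨hυ.1, hυ.2.weaken
      (by simp +contextual [Prog.writesReg]) (by simp +contextual [Prog.writesMem])⟩)
  | loop_done h h' => exact .loop_done h ⟨h', .refl _ _⟩
  | loop_step h _ _ ih ih' =>
    refine .loop_step h ih fun τ hτ => (ih' τ hτ.1).mono le_rfl fun υ hυ => ⟨hυ.1, ?_⟩
    exact (hτ.2.weaken (by simp [Prog.writesReg]) (by simp [Prog.writesMem])).trans hυ.2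
  | weaken htu hQ _ ih => exact ih.mono htu fun τ hτ => ⟨hQ τ hτ.1, hτ.2⟩

/-- Sequential composition, with the frame of the first program. -/
theorem Terminates.seq_frame {p q : Prog} {t u : ℕ} {σ : Store} {Q R : Store → Prop}
    (h : Terminates w p t σ R)
    (h' : ∀ τ, R τ → Unchanged p σ τ → Terminates w q u τ Q) :
    Terminates w (.seq p q) (t + u + 1) σ Q :=
  .seq h.frame fun τ hτ => h' τ hτ.1 hτ.2

/-! ### Straight-line programs -/

/-- Programs without loops and random choices. -/
def Prog.Straight : Prog → Prop
  | .skip => True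
  | .assign _ _ => True
  | .store _ _ _ => True
  | .rand _ _ => False
  | .seq p q => p.Straight ∧ q.Straight
  | .cond _ p q => p.Straight ∧ q.Straight
  | .loop _ _ => False

/-- The effect of a straight-line program. -/
def Prog.exec (w : ℕ) : Prog → Store → Store
  | .assign r e, σ => σ.setReg r (e.eval w σ)
  | .store b a e, σ => σ.setMem b (a.eval w σ) (e.eval w σ)
  | .seq p q, σ => q.exec w (p.exec w σ)
  | .cond e p q, σ => if e.eval w σ ≠ 0 then p.exec w σ else q.exec w σ
  | _, σ => σ

/-- A bound on the running time of a straight-line program. -/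
def Prog.cost : Prog → ℕ
  | .seq p q => p.cost + q.cost + 1
  | .cond _ p q => p.cost + q.cost + 1
  | _ => 1

theorem Prog.Straight.terminates {p : Prog} (hp : p.Straight) {σ : Store} {Q : Store → Prop}
    (hQ : Q (p.exec w σ)) : Terminates w p p.cost σ Q := by
  have key : ∀ p : Prog, p.Straight → ∀ σ, Terminates w p p.cost σ (fun τ => τ = p.exec w σ) := by
    intro p
    induction p with
    | skip => exact fun _ σ => .skip rfl
    | assign r e => exact fun _ σ => .assign rfl
    | store b a e => exact fun _ σ => .store rfl
    | rand r e => exact fun h => h.elim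
    | seq p q ihp ihq =>
      intro h σ
      refine .seq (ihp h.1 σ) fun τ hτ => ?_
      subst hτ
      exact ihq h.2 _
    | cond e p q ihp ihq =>
      intro h σ
      by_cases he : e.eval w σ = 0
      · exact (Terminates.cond_false he (ihq h.2 σ)).mono (by simp [Prog.cost])
          (fun τ hτ => by simpa [Prog.exec, he] using hτ)
      · exact (Terminates.cond_true he (ihp h.1 σ)).mono (by simp [Prog.cost])
          (fun τ hτ => by simpa [Prog.exec, he] using hτ)
    | loop e p => exact fun h => h.elim
  exact (key p hp σ).mono le_rfl fun τ hτ => hτ ▸ hQ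

/-! ### For loops -/

/-- `for i := a to b - 1 do p`, where `b` is evaluated anew in every iteration. -/
def forLoop (i : ℕ) (a b : Exp) (p : Prog) : Prog :=
  .seq (.assign i a) (.loop (.bin .lt (.reg i) b) (.seq p (.assign i (.bin .add (.reg i) (.lit 1)))))

/-- The bound `hi < 2 ^ w` keeps the counter from wrapping around. The time `t j` may depend on the
iteration, which is needed to charge a vertex only its degree. -/
theorem Terminates.forLoop {i : ℕ} {a b : Exp} {p : Prog} {σ : Store} {lo hi : ℕ}
    (I : ℕ → Store → Prop) (t : ℕ → ℕ) (hw : hi < 2 ^ w) (ha : a.eval w σ = lo) (hle : lo ≤ hi)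
    (hp : p.writesReg i = false)
    (hb : ∀ τ, Unchanged (WordRAM.forLoop i a b p) σ τ → b.eval w τ = hi)
    (h0 : I lo (σ.setReg i lo))
    (hs : ∀ j τ, lo ≤ j → j < hi → Unchanged (WordRAM.forLoop i a b p) σ τ → τ.reg i = j → I j τ →
      Terminates w p (t j) τ (fun υ => I (j + 1) (υ.setReg i (j + 1)))) :
    Terminates w (WordRAM.forLoop i a b p) (∑ j ∈ Finset.Ico lo hi, (t j + 3) + 3) σ (I hi) := by
  have h1 : ∀ j τ, lo ≤ j → j ≤ hi → Unchanged (WordRAM.forLoop i a b p) σ τ → τ.reg i = j →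
      I j τ → Terminates w (.loop (.bin .lt (.reg i) b)
        (.seq p (.assign i (.bin .add (.reg i) (.lit 1)))))
        (∑ j ∈ Finset.Ico j hi, (t j + 3) + 1) τ (I hi) := by
    intro j τ hlj hjh
    -- Downward induction from `hi`, since the loop rule describes the first of the remaining
    -- iterations.
    induction hjh using Nat.decreasingInduction generalizing τ with
    | self =>
      intro hU hj hI
      simp only [Finset.Ico_self, Finset.sum_empty]
      exact .loop_done (by simp [Exp.eval, Op.eval, hb τ hU, hj]) hI
    | of_succ j hjh ih =>
      intro hU hj hI
      have h1w : 1 < 2 ^ w := by omega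
      rw [Finset.sum_eq_sum_Ico_succ_bot hjh]
      refine Terminates.mono (.loop_step (t := t j + 1 + 1) ?_
        (.seq_frame (hs j τ hlj hjh hU hj hI) fun υ hυ hUυ => .assign (Q := fun ρ =>
          I (j + 1) ρ ∧ Unchanged (WordRAM.forLoop i a b p) σ ρ ∧ ρ.reg i = j + 1) ?_)
        fun υ hυ => ih υ (by omega) hυ.2.1 hυ.2.2 hυ.1) (by omega) (fun _ h => h)
      · simp [Exp.eval, Op.eval, hb τ hU, hj, hjh, Nat.mod_eq_of_lt h1w]
      · have : Exp.eval w υ (.bin .add (.reg i) (.lit 1)) = j + 1 := by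
          simp only [Exp.eval, Op.eval, hUυ.reg i hp, hj, Nat.mod_eq_of_lt h1w]
          exact Nat.mod_eq_of_lt (by omega)
        rw [this]
        refine ⟨hυ, hU.trans ⟨fun r hr => ?_, fun b hb => ?_⟩, by simp [Store.setReg]⟩
        · simp only [WordRAM.forLoop, Prog.writesReg, Bool.or_eq_false_iff,
            beq_eq_false_iff_ne] at hr
          simpa [Store.setReg, Function.update_apply, hr.1.symm] using hUυ.reg r hr.2.1
        · simp only [WordRAM.forLoop, Prog.writesMem, Bool.or_eq_false_iff] at hb
          simpa [Store.setReg] using hUυ.mem b hb.2.1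
  refine Terminates.mono (.seq (.assign (Q := fun τ => τ = σ.setReg i lo) (by rw [ha]))
    fun τ hτ => h1 lo τ le_rfl hle ?_ ?_ ?_) (by omega) (fun _ h => h)
  · subst hτ
    refine ⟨fun r hr => ?_, fun b hb => rfl⟩
    simp only [WordRAM.forLoop, Prog.writesReg, Bool.or_eq_false_iff, beq_eq_false_iff_ne] at hr
    simp [Store.setReg, hr.1.symm]
  · simp [hτ, Store.setReg]
  · rw [hτ]; exact h0

/-- A loop `for i := 0 to hi - 1` whose body takes bounded time. -/
theorem Terminates.forLoop_const {i : ℕ} {b : Exp} {p : Prog} {σ : Store} {hi : ℕ}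
    (I : ℕ → Store → Prop) (t : ℕ) (hw : hi < 2 ^ w) (hp : p.writesReg i = false)
    (hb : ∀ τ, Unchanged (WordRAM.forLoop i (.lit 0) b p) σ τ → b.eval w τ = hi)
    (h0 : I 0 (σ.setReg i 0))
    (hs : ∀ j τ, j < hi → Unchanged (WordRAM.forLoop i (.lit 0) b p) σ τ → τ.reg i = j → I j τ →
      Terminates w p t τ (fun υ => I (j + 1) (υ.setReg i (j + 1)))) :
    Terminates w (WordRAM.forLoop i (.lit 0) b p) (hi * (t + 3) + 3) σ (I hi) := by
  have := Terminates.forLoop I (fun _ => t) hw (a := .lit 0) (lo := 0) (by simp [Exp.eval])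
    (Nat.zero_le _) hp hb h0 (fun j τ _ => hs j τ)
  simpa using this

/-! ### Runs of the machine -/

theorem run_add (s u : ℕ) (C : Config) :
    run w (s + u) C = (run w s C).bind (run w u) := by
  induction s generalizing C with
  | zero => simp [run]
  | succ s ih =>
    rw [Nat.succ_add]
    simp only [run, PMF.bind_bind]
    congr 1
    funext D
    exact ih D

theorem run_nil (t : ℕ) (σ : Store) : run w t ⟨[], σ⟩ = PMF.pure ⟨[], σ⟩ := by
  induction t with
  | zero => rfl
  | succ t ih => simp [run, step, ih]

/-- From the configuration `C`, the machine surely halts within `t` steps, and the probability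
that it halts in a store outside `S` is at most `b`. -/
def Safe (w : ℕ) (S : Set Store) (t : ℕ) (b : ENNReal) (C : Config) : Prop :=
  (∀ D ∈ (run w t C).support, D.Halted) ∧
    (run w t C).toOuterMeasure {D | ¬ (D.Halted ∧ D.store ∈ S)} ≤ b

variable {S : Set Store}

/-- After `s` steps the run is supported on halting configurations, which no longer change, so later
distributions are the same. -/
theorem Safe.mono {s t : ℕ} {b c : ENNReal} {C : Config} (h : Safe w S s b C) (hst : s ≤ t)
    (hbc : b ≤ c) : Safe w S t c C := by
  obtain ⟨u, rfl⟩ := Nat.exists_eq_add_of_le hst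
  have : run w (s + u) C = run w s C := by
    rw [run_add]
    conv_rhs => rw [← PMF.bind_pure (run w s C)]
    ext D
    simp only [PMF.bind_apply]
    refine tsum_congr fun E => ?_
    by_cases hE : E ∈ (run w s C).support
    · have := h.1 E hE
      obtain ⟨l, σ⟩ := E
      simp only [Config.Halted] at this
      subst this
      rw [run_nil]
    · simp only [PMF.mem_support_iff, not_not] at hE
      simp [hE]
  rw [Safe, this]
  exact ⟨h.1, h.2.trans hbc⟩

theorem Safe.nil {σ : Store} {b : ENNReal} (t : ℕ) (h : σ ∈ S ∨ 1 ≤ b) : Safe w S t b ⟨[], σ⟩ := by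
  rw [Safe, run_nil]
  refine ⟨by simp [Config.Halted], ?_⟩
  rw [PMF.toOuterMeasure_pure_apply]
  split_ifs with h'
  · simp only [Config.Halted, Set.mem_ofPred_eq, true_and] at h'
    exact h.resolve_left h'
  · exact zero_le

theorem Safe.of_step_pure {t : ℕ} {b : ENNReal} {C D : Config} (h : step w C = PMF.pure D)
    (hD : Safe w S t b D) : Safe w S (t + 1) b C := by
  rw [Safe, run, h, PMF.pure_bind]
  exact hD

/-- The bridge between the two logics: a deterministic prefix costs time but no probability,
whatever the continuation `l` does. -/
theorem Terminates.safe {p : Prog} {t : ℕ} {σ : Store} {Q : Store → Prop}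
    (h : Terminates w p t σ Q) {l : List Prog} {s : ℕ} {b : ENNReal}
    (hQ : ∀ τ, Q τ → Safe w S s b ⟨l, τ⟩) : Safe w S (t + s) b ⟨p :: l, σ⟩ := by
  induction h generalizing l s with
  | skip h => exact (Safe.of_step_pure rfl (hQ _ h)).mono (by omega) le_rfl
  | assign h => exact (Safe.of_step_pure rfl (hQ _ h)).mono (by omega) le_rfl
  | store h => exact (Safe.of_step_pure rfl (hQ _ h)).mono (by omega) le_rfl
  | seq _ _ ih ih' =>
    exact (Safe.of_step_pure rfl (ih fun τ hτ => ih' τ hτ hQ)).mono (by omega) le_rfl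
  | cond_true h _ ih =>
    refine (Safe.of_step_pure ?_ (ih hQ)).mono (by omega) le_rfl
    rw [step, if_pos h]
  | cond_false h _ ih =>
    refine (Safe.of_step_pure ?_ (ih hQ)).mono (by omega) le_rfl
    rw [step, if_neg (by simpa using h)]
  | loop_done h h' =>
    refine (Safe.of_step_pure ?_ (hQ _ h')).mono (by omega) le_rfl
    rw [step, if_neg (by simpa using h)]
  | loop_step h _ _ ih ih' =>
    refine (Safe.of_step_pure ?_ (ih fun τ hτ => ih' τ hτ hQ)).mono (by omega) le_rfl
    rw [step, if_pos h]
  | weaken htu hR _ ih => exact (ih fun τ hτ => hQ τ (hR τ hτ)).mono (by omega) le_rfl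

theorem uniformBelow_apply {k : ℕ} (hk : 0 < k) (x : ℕ) :
    uniformBelow k x = if x < k then (k : ENNReal)⁻¹ else 0 := by
  obtain ⟨k, rfl⟩ := Nat.exists_eq_succ_of_ne_zero hk.ne'
  rw [uniformBelow, PMF.map_apply, tsum_fintype]
  simp only [PMF.uniformOfFintype_apply, Fintype.card_fin]
  split_ifs with h
  · rw [Finset.sum_eq_single (⟨x, h⟩ : Fin (k + 1))]
    · simp
    · intro y _ hy
      rw [if_neg]
      rintro rfl
      exact hy rfl
    · simp
  · refine Finset.sum_eq_zero fun y _ => if_neg ?_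
    rintro rfl
    exact h y.2

/-- A random choice: the failure probability is the average over the outcomes. -/
theorem Safe.rand {r : ℕ} {e : Exp} {l : List Prog} {σ : Store} {t k : ℕ} {b : ℕ → ENNReal}
    (hk : e.eval w σ = k) (h0 : 0 < k) (h : ∀ x < k, Safe w S t (b x) ⟨l, σ.setReg r x⟩) :
    Safe w S (t + 1) ((∑ x ∈ Finset.range k, b x) / k) ⟨.rand r e :: l, σ⟩ := by
  have hrun : run w (t + 1) ⟨.rand r e :: l, σ⟩ =
      (uniformBelow k).bind fun x => run w t ⟨l, σ.setReg r x⟩ := by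
    rw [run, step, hk, PMF.bind_map]
    rfl
  rw [Safe, hrun]
  constructor
  · intro D hD
    rw [PMF.mem_support_bind_iff] at hD
    obtain ⟨x, hx, hD⟩ := hD
    rw [PMF.mem_support_iff, uniformBelow_apply h0] at hx
    have hx' : x < k := by
      by_contra hxk
      exact hx (if_neg hxk)
    exact (h x hx').1 D hD
  · rw [PMF.toOuterMeasure_bind_apply, tsum_eq_sum (s := Finset.range k)]
    · rw [ENNReal.div_eq_inv_mul, Finset.mul_sum]
      refine Finset.sum_le_sum fun x hx => ?_
      rw [Finset.mem_range] at hx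
      rw [uniformBelow_apply h0, if_pos hx]
      exact mul_le_mul_right (h x hx).2 _
    · intro x hx
      rw [Finset.mem_range] at hx
      rw [uniformBelow_apply h0, if_neg hx, zero_mul]

end WordRAM

/-! ## The program -/

namespace WordRAM

/-- `n` and the lists `nbr 0, …, nbr (n - 1)` are the input in the store `σ`. -/
structure HasInput (n : ℕ) (nbr : ℕ → List ℕ) (σ : Store) : Prop where
  size : σ.reg 0 = n
  start : ∀ a ≤ n, σ.mem 0 a = ∑ u ∈ Finset.range a, (nbr u).length
  entry : ∀ a < n, ∀ j (h : j < (nbr a).length),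
    σ.mem 1 (∑ u ∈ Finset.range a, (nbr u).length + j) = (nbr a)[j]

theorem HasInput.of_unchanged {n : ℕ} {nbr : ℕ → List ℕ} {σ τ : Store} {p : Prog}
    (h : HasInput n nbr σ) (hp : Unchanged p σ τ) (h0 : p.writesReg 0 = false)
    (h1 : p.writesMem 0 = false) (h2 : p.writesMem 1 = false) : HasInput n nbr τ :=
  ⟨by rw [hp.reg 0 h0, h.size], fun a ha => by rw [hp.mem 0 h1, h.start a ha],
    fun a ha j hj => by rw [hp.mem 1 h2, h.entry a ha j hj]⟩

theorem HasInput.setReg {n : ℕ} {nbr : ℕ → List ℕ} {σ : Store} {r x : ℕ}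
    (h : HasInput n nbr σ) (hr : r ≠ 0) : HasInput n nbr (σ.setReg r x) :=
  ⟨by simp [Store.setReg, hr.symm, h.size], h.start, h.entry⟩

@[simp] theorem setReg_mem (σ : Store) (r x : ℕ) : (σ.setReg r x).mem = σ.mem := rfl

@[simp] theorem setMem_reg (σ : Store) (b a x : ℕ) : (σ.setMem b a x).reg = σ.reg := rfl

theorem setReg_reg (σ : Store) (r x s : ℕ) :
    (σ.setReg r x).reg s = if s = r then x else σ.reg s := by
  simp [Store.setReg, Function.update_apply]

theorem setMem_mem (σ : Store) (b a x c d : ℕ) :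
    (σ.setMem b a x).mem c d = if c = b ∧ d = a then x else σ.mem c d := by
  by_cases h : c = b
  · subst h; simp [Store.setMem, Function.update_apply]
  · simp [Store.setMem, h]

/-! ### Partitioning the vertices by their traces on a marked set -/

/-- Give the vertex `bank1[reg9]` a label that depends on its old label. -/
def relabel : Prog :=
  .seq (.assign 10 (.read 5 (.read 1 (.reg 9))))
    (.seq (.cond (.bin .lt (.read 6 (.reg 10)) (.reg 8))
        (.seq (.store 6 (.reg 10) (.reg 7))
          (.seq (.store 6 (.reg 7) (.lit 0)) (.assign 7 (.bin .add (.reg 7) (.lit 1))))) .skip)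
      (.store 5 (.read 1 (.reg 9)) (.read 6 (.reg 10))))

/-- Split all classes according to adjacency to the vertex in register `12`. -/
def split : Prog :=
  .seq (.assign 8 (.reg 7))
    (forLoop 9 (.read 0 (.reg 12)) (.read 0 (.bin .add (.reg 12) (.lit 1))) relabel)

/-- Label the vertices, in bank `5`, by their traces on the set marked in bank `3`. -/
def partition : Prog :=
  .seq (.store 6 (.lit 0) (.lit 0)) (.seq (.assign 7 (.lit 1))
    (.seq (forLoop 5 (.lit 0) (.reg 0) (.store 5 (.reg 5) (.lit 0)))
      (forLoop 12 (.lit 0) (.reg 0) (.cond (.read 3 (.reg 12)) split .skip))))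

variable {w : ℕ}

/-- The state of the labels `cl'` and of the table `nl` of new labels after the vertices in `S`
have been relabelled; the labels were `cl` before, and the labels from `c` on are new. -/
structure Relabelled (n c : ℕ) (cl : ℕ → ℕ) (S : List ℕ) (cnt : ℕ) (cl' nl : ℕ → ℕ) : Prop where
  le : c ≤ cnt
  of_mem : ∀ x < n, x ∈ S → cl' x = nl (cl x)
  of_notMem : ∀ x < n, x ∉ S → cl' x = cl x
  lt : ∀ d < cnt, nl d < cnt
  ge : ∀ x < n, x ∈ S → c ≤ nl (cl x)
  inj : ∀ d < c, ∀ d' < c, c ≤ nl d → nl d = nl d' → d = d'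

namespace Relabelled

variable {n c cnt y : ℕ} {cl cl' cl'' nl nl' : ℕ → ℕ} {S S' : List ℕ}

/-- The first relabelled vertex of its class: an entry of `nl` below the threshold `c` is stale. The
entry of the new label `cnt` is set to `0`, so that it is stale in the next pass. -/
theorem fresh (h : Relabelled n c cl S cnt cl' nl) (hcl : ∀ x < n, cl x < c) (hy : y < n)
    (hS : ∀ x, x ∈ S' ↔ x ∈ S ∨ x = y) (hlow : nl (cl y) < c)
    (h5 : ∀ x, cl'' x = if x = y then cnt else cl' x)
    (h6 : ∀ d, nl' d = if d = cnt then 0 else if d = cl y then cnt else nl d) :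
    Relabelled n c cl S' (cnt + 1) cl'' nl' := by
  have hle := h.le
  have hne : ∀ x < n, cl x ≠ cnt := fun x hx => by have := hcl x hx; omega
  refine ⟨by omega, ?_, ?_, ?_, ?_, ?_⟩
  · intro x hx hxS
    rw [h5, h6, if_neg (hne x hx)]
    split_ifs with h1 h2 h2
    · rfl
    · exact absurd (by rw [h1]) h2
    · have hxS' := ((hS x).1 hxS).resolve_right h1
      have := h.ge x hx hxS'
      rw [h2] at this
      omega
    · exact h.of_mem x hx (((hS x).1 hxS).resolve_right h1)
  · intro x hx hxS
    rw [hS, not_or] at hxS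
    rw [h5, if_neg hxS.2, h.of_notMem x hx hxS.1]
  · intro d hd
    rw [h6]
    split_ifs with h1
    · omega
    · omega
    · have := h.lt d (by omega)
      omega
  · intro x hx hxS
    rw [h6, if_neg (hne x hx)]
    split_ifs with h2
    · omega
    · refine h.ge x hx (((hS x).1 hxS).resolve_right ?_)
      rintro rfl
      exact h2 rfl
  · intro d hd d' hd'
    have := h.inj d hd d' hd'
    have := h.lt d (by omega)
    have := h.lt d' (by omega)
    rw [h6, h6]
    split_ifs <;> omega

theorem old (h : Relabelled n c cl S cnt cl' nl) (hS : ∀ x, x ∈ S' ↔ x ∈ S ∨ x = y)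
    (hlow : ¬ nl (cl y) < c) (h5 : ∀ x, cl'' x = if x = y then nl (cl y) else cl' x) :
    Relabelled n c cl S' cnt cl'' nl := by
  refine ⟨h.le, ?_, ?_, h.lt, ?_, h.inj⟩
  · intro x hx hxS
    rw [h5]
    split_ifs with h1
    · rw [h1]
    · exact h.of_mem x hx (((hS x).1 hxS).resolve_right h1)
  · intro x hx hxS
    rw [hS, not_or] at hxS
    rw [h5, if_neg hxS.2, h.of_notMem x hx hxS.1]
  · intro x hx hxS
    rcases (hS x).1 hxS with h1 | rfl
    · exact h.ge x hx h1
    · omega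

theorem lt_cnt (h : Relabelled n c cl S cnt cl' nl) (hcl : ∀ x < n, cl x < c) {x : ℕ}
    (hx : x < n) : cl' x < cnt := by
  have h1 := hcl x hx
  have h2 := h.le
  by_cases hxS : x ∈ S
  · rw [h.of_mem x hx hxS]
    exact h.lt _ (by omega)
  · rw [h.of_notMem x hx hxS]
    omega

/-- Relabelled vertices have labels from `c` on and the others keep labels below `c`, so the two
kinds are separated; among relabelled vertices, `nl` is injective on the classes met. -/
theorem eq_iff (h : Relabelled n c cl S cnt cl' nl) (hcl : ∀ x < n, cl x < c) {x y : ℕ}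
    (hx : x < n) (hy : y < n) : cl' x = cl' y ↔ (cl x = cl y ∧ (x ∈ S ↔ y ∈ S)) := by
  have h1 := hcl x hx
  have h2 := hcl y hy
  by_cases hxS : x ∈ S <;> by_cases hyS : y ∈ S
  · rw [h.of_mem x hx hxS, h.of_mem y hy hyS]
    exact ⟨fun h' => ⟨h.inj _ h1 _ h2 (h.ge x hx hxS) h', by tauto⟩, fun h' => by rw [h'.1]⟩
  · have := h.ge x hx hxS
    rw [h.of_mem x hx hxS, h.of_notMem y hy hyS]
    exact ⟨fun h' => by omega, fun h' => absurd (h'.2.1 hxS) hyS⟩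
  · have := h.ge y hy hyS
    rw [h.of_mem y hy hyS, h.of_notMem x hx hxS]
    exact ⟨fun h' => by omega, fun h' => absurd (h'.2.2 hyS) hxS⟩
  · rw [h.of_notMem x hx hxS, h.of_notMem y hy hyS]
    tauto

end Relabelled

/-- Time proportional to the degree is possible because the table in bank `6` is never cleared: all
its entries are below the current number of labels, which is the threshold of the next pass. -/
theorem split_spec {n : ℕ} {nbr : ℕ → List ℕ} {σ : Store} {v : ℕ} (hin : HasInput n nbr σ)
    (hv : v < n) (hr : σ.reg 12 = v) (hnd : (nbr v).Nodup) (hlt : ∀ x ∈ nbr v, x < n)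
    (hw : n < 2 ^ w) (hw' : σ.reg 7 + (nbr v).length < 2 ^ w)
    (hN : ∑ u ∈ Finset.range (v + 1), (nbr u).length < 2 ^ w)
    (hcls : ∀ x < n, σ.mem 5 x < σ.reg 7)
    (hnl : ∀ d < σ.reg 7, σ.mem 6 d < σ.reg 7) :
    Terminates w split ((nbr v).length * 14 + 5) σ (fun τ =>
      σ.reg 7 ≤ τ.reg 7 ∧ τ.reg 7 ≤ σ.reg 7 + (nbr v).length ∧
      (∀ x < n, τ.mem 5 x < τ.reg 7) ∧ (∀ d < τ.reg 7, τ.mem 6 d < τ.reg 7) ∧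
      ∀ x < n, ∀ y < n, τ.mem 5 x = τ.mem 5 y ↔
        (σ.mem 5 x = σ.mem 5 y ∧ (x ∈ nbr v ↔ y ∈ nbr v))) := by
  set c := σ.reg 7 with hc
  set o := ∑ u ∈ Finset.range v, (nbr u).length with ho
  have ho' : ∑ u ∈ Finset.range (v + 1), (nbr u).length = o + (nbr v).length :=
    Finset.sum_range_succ _ _
  have h1w : 1 < 2 ^ w := by omega
  let I : ℕ → Store → Prop := fun j τ => τ.reg 7 + o ≤ c + j ∧ τ.reg 8 = c ∧
      Relabelled n c (σ.mem 5) ((nbr v).take (j - o)) (τ.reg 7) (τ.mem 5) (τ.mem 6)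
  refine Terminates.mono (.seq_frame (.assign (Q := fun τ => τ = σ.setReg 8 c) (by simp [Exp.eval, hc]))
    fun τ hτ _ => Terminates.forLoop (lo := o) (hi := o + (nbr v).length) I (fun _ => 11)
      (by omega) ?_ (by omega) rfl ?_ ?_ ?_) ?_ ?_
  · subst hτ
    simp [Exp.eval, setReg_reg, hr, hin.start v hv.le, ho]
  · intro υ hU
    have e0 := hU.mem 0 rfl
    have e12 := hU.reg 12 rfl
    simp only [hτ, setReg_mem, setReg_reg] at e0 e12
    simp [Exp.eval, Op.eval, e0, e12, hr, Nat.mod_eq_of_lt h1w,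
      Nat.mod_eq_of_lt (show v + 1 < 2 ^ w by omega), hin.start (v + 1) hv, ho']
  · subst hτ
    refine ⟨by simp [setReg_reg, hc], by simp [setReg_reg], ?_⟩
    simp only [setReg_mem, setReg_reg, ← hc]
    refine ⟨le_rfl, by simp, by simp, by simpa using hnl, by simp, ?_⟩
    intro d hd d' _ h
    have := hnl d hd
    omega
  · intro j υ hj1 hj2 hU hj hI
    obtain ⟨i, rfl⟩ := Nat.exists_eq_add_of_le hj1
    have hi : i < (nbr v).length := by omega
    have e1 : υ.mem 1 (o + i) = (nbr v)[i] := by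
      have := hU.mem 1 rfl
      rw [this, hτ, setReg_mem]
      exact hin.entry v hv i hi
    obtain ⟨I2, I3, I4⟩ := hI
    simp only [Nat.add_sub_cancel_left] at I4
    have htake : ∀ x, x ∈ (nbr v).take (i + 1) ↔ x ∈ (nbr v).take i ∨ x = (nbr v)[i] := by
      intro x
      rw [List.take_succ_eq_append_getElem hi, List.mem_append, List.mem_singleton]
    -- Without repetitions in the list, the label read for this vertex is still the old one.
    have hnot : (nbr v)[i] ∉ (nbr v).take i := by
      intro hmem
      rw [List.mem_take_iff_getElem] at hmem
      obtain ⟨j, hj, hj'⟩ := hmem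
      have := (List.Nodup.getElem_inj_iff hnd).1 hj'
      omega
    set y := (nbr v)[i] with hy
    have hyn : y < n := hlt y (List.getElem_mem hi)
    have hcy : υ.mem 5 y = σ.mem 5 y := I4.of_notMem y hyn hnot
    have hcls' := hcls y hyn
    have hle := I4.le
    refine Prog.Straight.terminates (p := relabel) (by simp [relabel, Prog.Straight]) ?_
    have h7 : (υ.reg 7 + 1) % 2 ^ w = υ.reg 7 + 1 := Nat.mod_eq_of_lt (by omega)
    have hsub : o + i + 1 - o = i + 1 := by omega
    by_cases hlow : υ.mem 6 (σ.mem 5 y) < c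
    · have e : (relabel.exec w υ).reg 7 = υ.reg 7 + 1 ∧ (relabel.exec w υ).reg 8 = c ∧
          (∀ x, (relabel.exec w υ).mem 5 x = if x = y then υ.reg 7 else υ.mem 5 x) ∧
          (∀ d, (relabel.exec w υ).mem 6 d = if d = υ.reg 7 then 0 else
            if d = σ.mem 5 y then υ.reg 7 else υ.mem 6 d) := by
        have : ¬ σ.mem 5 y = υ.reg 7 := by omega
        simp [relabel, Prog.exec, Exp.eval, Op.eval, setReg_reg, setMem_mem, hj, e1, hcy, I3,
          hlow, Nat.mod_eq_of_lt h1w, h7, this]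
      obtain ⟨E7, E8, E5, E6⟩ := e
      refine ⟨?_, ?_, ?_⟩ <;> simp only [setReg_mem, setReg_reg, E7, E8, hsub]
      · simp; omega
      · rfl
      · exact I4.fresh hcls hyn htake hlow E5 E6
    · have e : (relabel.exec w υ).reg 7 = υ.reg 7 ∧ (relabel.exec w υ).reg 8 = c ∧
          (∀ x, (relabel.exec w υ).mem 5 x = if x = y then υ.mem 6 (σ.mem 5 y) else υ.mem 5 x) ∧
          (relabel.exec w υ).mem 6 = υ.mem 6 := by
        simp [relabel, Prog.exec, Exp.eval, Op.eval, setReg_reg, hj, e1, hcy, I3,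
          hlow, Store.setMem, Function.update_apply]
      obtain ⟨E7, E8, E5, E6⟩ := e
      refine ⟨?_, ?_, ?_⟩ <;> simp only [setReg_mem, setReg_reg, E7, E8, hsub]
      · simp; omega
      · rfl
      · rw [E6]
        exact I4.old htake hlow E5
  · simp [Finset.sum_const]
    omega
  · rintro υ ⟨I2, I3, I4⟩
    simp only [Nat.add_sub_cancel_left, List.take_length] at I4
    exact ⟨I4.le, by omega, fun x hx => I4.lt_cnt hcls hx, I4.lt,
      fun x hx y hy => I4.eq_iff hcls hx hy⟩

/-- Starting from a single class, one split per marked vertex. Each split creates at most as many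
labels as the degree, so all labels fit into a word. -/
theorem partition_spec {n : ℕ} {nbr : ℕ → List ℕ} {σ : Store} (hin : HasInput n nbr σ)
    (hnd : ∀ v < n, (nbr v).Nodup) (hlt : ∀ v < n, ∀ x ∈ nbr v, x < n)
    (hw : n + ∑ u ∈ Finset.range n, (nbr u).length + 1 < 2 ^ w) :
    Terminates w partition (n * 18 + (∑ u ∈ Finset.range n, (nbr u).length) * 14 + 20) σ (fun τ =>
      ∀ x < n, ∀ y < n, τ.mem 5 x = τ.mem 5 y ↔
        ∀ v < n, σ.mem 3 v ≠ 0 → (x ∈ nbr v ↔ y ∈ nbr v)) := by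
  set N := ∑ u ∈ Finset.range n, (nbr u).length with hN
  have h1w : 1 < 2 ^ w := by omega
  have hmono : ∀ v ≤ n, ∑ u ∈ Finset.range v, (nbr u).length ≤ N := fun v hv =>
    Finset.sum_le_sum_of_subset (Finset.range_subset_range.2 hv)
  let I : ℕ → Store → Prop := fun j τ => 1 ≤ τ.reg 7 ∧
      τ.reg 7 ≤ 1 + ∑ u ∈ Finset.range j, (nbr u).length ∧
      (∀ x < n, τ.mem 5 x < τ.reg 7) ∧ (∀ d < τ.reg 7, τ.mem 6 d < τ.reg 7) ∧
      ∀ x < n, ∀ y < n, τ.mem 5 x = τ.mem 5 y ↔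
        ∀ v < j, σ.mem 3 v ≠ 0 → (x ∈ nbr v ↔ y ∈ nbr v)
  refine Terminates.mono (.seq_frame (.store (Q := fun τ => τ.mem 6 0 = 0) ?_) fun τ hτ hUτ =>
    .seq_frame (.assign (Q := fun τ => τ.reg 7 = 1) ?_) fun υ hυ hUυ =>
    .seq_frame (Terminates.forLoop_const (hi := n) (fun j τ => ∀ x < j, τ.mem 5 x = 0) 1
      (by omega) rfl ?_ ?_ ?_) fun ρ hρ hUρ => Terminates.forLoop (lo := 0) (hi := n) I
      (fun v => (nbr v).length * 14 + 6) (by omega) ?_ (by omega) rfl ?_ ?_ ?_) ?_ ?_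
  · simp [setMem_mem, Exp.eval]
  · simp [setReg_reg, Exp.eval, Nat.mod_eq_of_lt h1w]
  · intro ρ hU
    have := ((hin.of_unchanged hUτ rfl rfl rfl).of_unchanged hUυ rfl rfl rfl).of_unchanged hU
      rfl rfl rfl
    exact this.size
  · simp
  · intro j ρ hj hU hρj hI
    refine .store ?_
    intro x hx
    simp only [Exp.eval, hρj, setReg_mem, setMem_mem, Nat.zero_mod]
    grind
  · simp [Exp.eval]
  · intro ρ' hU
    exact ((((hin.of_unchanged hUτ rfl rfl rfl).of_unchanged hUυ rfl rfl rfl).of_unchanged hUρ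
      rfl rfl rfl).of_unchanged hU rfl rfl rfl).size
  · have e7 : ρ.reg 7 = 1 := by rw [hUρ.reg 7 rfl, hυ]
    have e6 : ρ.mem 6 0 = 0 := by rw [hUρ.mem 6 rfl, hUυ.mem 6 rfl, hτ]
    refine ⟨by simp [setReg_reg, e7], by simp [setReg_reg, e7], ?_, ?_, ?_⟩
    · intro x hx
      simp [setReg_reg, e7, hρ x hx]
    · intro d hd
      simp only [setReg_reg, e7] at hd
      have : d = 0 := by simpa using hd
      subst this
      simp [setReg_reg, e7, e6]
    · intro x hx y hy
      simp [hρ x hx, hρ y hy]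
  · intro j θ _ hj hU hθj ⟨I1, I2, I3, I4, I5⟩
    have e3 : θ.mem 3 j = σ.mem 3 j := by
      rw [hU.mem 3 rfl, hUρ.mem 3 rfl, hUυ.mem 3 rfl, hUτ.mem 3 rfl]
    have hle := hmono (j + 1) hj
    have hs : ∑ u ∈ Finset.range (j + 1), (nbr u).length =
      ∑ u ∈ Finset.range j, (nbr u).length + (nbr j).length := Finset.sum_range_succ _ _
    have hin' := (((hin.of_unchanged hUτ rfl rfl rfl).of_unchanged hUυ rfl rfl rfl).of_unchanged
      hUρ rfl rfl rfl).of_unchanged hU rfl rfl rfl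
    by_cases h3 : σ.mem 3 j = 0
    · refine Terminates.mono (.cond_false (by simp [Exp.eval, hθj, e3, h3]) (.skip
        (Q := fun τ => τ = θ) rfl)) (by omega) ?_
      rintro _ rfl
      refine ⟨by simpa [setReg_reg] using I1, ?_, by simpa [setReg_reg] using I3,
        by simpa [setReg_reg] using I4, ?_⟩
      · simp only [setReg_reg]
        simp
        omega
      · intro x hx y hy
        simp only [setReg_mem]
        rw [I5 x hx y hy, Nat.forall_lt_succ_right]
        simp [h3]
    · refine Terminates.mono (.cond_true (by simp [Exp.eval, hθj, e3, h3])
        (split_spec hin' hj hθj (hnd j hj) (hlt j hj) (by omega) (by omega) (by omega) I3 I4))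
        (by omega) ?_
      rintro φ ⟨J1, J2, J3, J4, J5⟩
      refine ⟨by simp [setReg_reg]; omega, ?_, by simpa [setReg_reg] using J3,
        by simpa [setReg_reg] using J4, ?_⟩
      · simp only [setReg_reg]
        simp
        omega
      · intro x hx y hy
        simp only [setReg_mem]
        rw [J5 x hx y hy, I5 x hx y hy, Nat.forall_lt_succ_right]
        simp [h3]
  · simp only [Nat.Ico_zero_eq_range, Finset.sum_add_distrib, Finset.sum_const, Finset.card_range,
      smul_eq_mul, ← Finset.sum_mul, ← hN]
    omega
  · exact fun θ hθ => hθ.2.2.2.2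

end WordRAM

namespace WordRAM

variable {w : ℕ}

/-- A loop over all vertices whose body is a straight-line program. -/
theorem Prog.Straight.forLoop {p : Prog} (hp : p.Straight) (I : ℕ → Store → Prop) {σ : Store}
    {n : ℕ} (hn : σ.reg 0 = n) (hw : n < 2 ^ w) (h5 : p.writesReg 5 = false)
    (hp0 : p.writesReg 0 = false) (h0 : I 0 (σ.setReg 5 0))
    (hs : ∀ j τ, j < n → Unchanged (forLoop 5 (.lit 0) (.reg 0) p) σ τ → τ.reg 5 = j → I j τ →
      I (j + 1) ((p.exec w τ).setReg 5 (j + 1))) :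
    Terminates w (forLoop 5 (.lit 0) (.reg 0) p) (n * (p.cost + 3) + 3) σ (I n) := by
  refine Terminates.forLoop_const I _ hw h5 ?_ h0 fun j τ hj hU h hI => hp.terminates ?_
  · intro τ hU
    rw [Exp.eval, hU.reg 0 (by simp [WordRAM.forLoop, Prog.writesReg, hp0]), hn]
  · exact hs j τ hj hU h hI

/-! ### Collecting and choosing representatives -/

/-- Empty the set marked in bank `3`, and list the fixed points of bank `10` in bank `4`. -/
def collect : Prog :=
  .seq (.assign 4 (.lit 0)) (forLoop 5 (.lit 0) (.reg 0)
    (.seq (.store 3 (.reg 5) (.lit 0))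
      (.cond (.bin .eq (.read 10 (.reg 5)) (.reg 5))
        (.seq (.store 4 (.reg 4) (.reg 5)) (.assign 4 (.bin .add (.reg 4) (.lit 1)))) .skip)))

/-- The list has no repetitions and is complete, so a uniform index into it is a uniform
representative. -/
theorem collect_spec {n : ℕ} {σ : Store} (hn : σ.reg 0 = n) (hw : n + 1 < 2 ^ w) :
    Terminates w collect (n * 10 + 5) σ (fun τ => (∀ x < n, τ.mem 3 x = 0) ∧
      (∀ i < τ.reg 4, τ.mem 4 i < n ∧ σ.mem 10 (τ.mem 4 i) = τ.mem 4 i) ∧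
      (∀ x < n, σ.mem 10 x = x → ∃ i < τ.reg 4, τ.mem 4 i = x) ∧
      ∀ i < τ.reg 4, ∀ j < τ.reg 4, τ.mem 4 i = τ.mem 4 j → i = j) := by
  have h1w : 1 < 2 ^ w := by omega
  let I : ℕ → Store → Prop := fun j τ => τ.reg 4 ≤ j ∧ (∀ x < j, τ.mem 3 x = 0) ∧
      (∀ i < τ.reg 4, τ.mem 4 i < j ∧ σ.mem 10 (τ.mem 4 i) = τ.mem 4 i) ∧
      (∀ x < j, σ.mem 10 x = x → ∃ i < τ.reg 4, τ.mem 4 i = x) ∧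
      ∀ i < τ.reg 4, ∀ j < τ.reg 4, τ.mem 4 i = τ.mem 4 j → i = j
  refine Terminates.mono (.seq_frame (.assign (Q := fun τ => τ.reg 4 = 0) ?_) fun τ hτ hUτ =>
    Prog.Straight.forLoop ?_ I ?_ ?_ rfl rfl ?_ ?_) ?_ (fun υ hυ => hυ.2)
  · simp [Exp.eval, setReg_reg]
  · simp [Prog.Straight]
  · rw [hUτ.reg 0 rfl, hn]
  · omega
  · simp [I, setReg_reg, hτ]
  · rintro j υ hj hU hυj ⟨I0, I1, I2, I3, I4⟩
    have e10 : υ.mem 10 = σ.mem 10 := by rw [hU.mem 10 rfl, hUτ.mem 10 rfl]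
    have h4 : (υ.reg 4 + 1) % 2 ^ w = υ.reg 4 + 1 := Nat.mod_eq_of_lt (by omega)
    have hlt : ∀ i < υ.reg 4, υ.mem 4 i < j := fun i hi => (I2 i hi).1
    by_cases hfix : σ.mem 10 j = j
    · simp [I, Prog.exec, Exp.eval, Op.eval, setReg_reg, setMem_mem, hυj, e10, hfix,
        Nat.mod_eq_of_lt h1w, h4]
      refine ⟨I0, ?_, ?_, ?_, ?_⟩
      · intro x hx hxj
        exact I1 x (by omega)
      · intro i hi
        split_ifs with h
        · exact ⟨by omega, hfix⟩
        · have := I2 i (by omega)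
          exact ⟨by omega, this.2⟩
      · intro x hx hxx
        by_cases hxj : x = j
        · exact ⟨υ.reg 4, by omega, by simp [hxj]⟩
        · obtain ⟨i, hi, hix⟩ := I3 x (by omega) hxx
          exact ⟨i, by omega, by rw [if_neg (by omega), hix]⟩
      · intro i hi i' hi' h
        split_ifs at h with h1 h2 h2
        · omega
        · have := hlt i' (by omega)
          omega
        · have := hlt i (by omega)
          omega
        · exact I4 i (by omega) i' (by omega) h
    · simp [I, Prog.exec, Exp.eval, Op.eval, setReg_reg, setMem_mem, hυj, e10, hfix]
      refine ⟨by omega, ?_, ?_, ?_, I4⟩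
      · intro x hx hxj
        exact I1 x (by omega)
      · intro i hi
        have := I2 i hi
        exact ⟨by omega, this.2⟩
      · intro x hx hxx
        refine I3 x ?_ hxx
        have : x ≠ j := by rintro rfl; exact hfix hxx
        omega
  · simp [Prog.cost]
    omega

/-- Mark, in bank `3`, one vertex of every class of vertices with the same label in bank `5`. -/
def represent : Prog :=
  .seq (forLoop 5 (.lit 0) (.reg 0) (.store 7 (.read 5 (.reg 5)) (.reg 5)))
    (forLoop 5 (.lit 0) (.reg 0)
      (.store 3 (.reg 5) (.bin .eq (.read 7 (.read 5 (.reg 5))) (.reg 5))))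

/-- Bank `7` records for each label the last vertex that carries it; exactly the recorded vertices
get marked. -/
theorem represent_spec {n : ℕ} {σ : Store} (hn : σ.reg 0 = n) (hw : n + 1 < 2 ^ w) :
    Terminates w represent (n * 8 + 7) σ (fun τ =>
      (∀ x < n, ∃ y < n, τ.mem 3 y ≠ 0 ∧ σ.mem 5 y = σ.mem 5 x) ∧
      ∀ x < n, ∀ y < n, τ.mem 3 x ≠ 0 → τ.mem 3 y ≠ 0 → σ.mem 5 x = σ.mem 5 y → x = y) := by
  have h1w : 1 < 2 ^ w := by omega
  unfold represent
  refine Terminates.mono (.seq_frame (Prog.Straight.forLoop (w := w) (n := n) (by trivial)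
      (fun j τ => ∀ x < j, ∃ y < j, τ.mem 7 (σ.mem 5 x) = y ∧ σ.mem 5 y = σ.mem 5 x)
      hn (by omega) rfl rfl (by simp) ?_) fun τ hτ hUτ => Terminates.mono (Prog.Straight.forLoop (w := w) (n := n) (by trivial)
      (fun j υ => ∀ x < j, υ.mem 3 x = if τ.mem 7 (σ.mem 5 x) = x then 1 else 0)
      (by rw [hUτ.reg 0 rfl, hn]) (by omega) rfl rfl (by simp) ?_) le_rfl ?_) ?_ (fun _ h => h)
  · intro j τ hj hU hτj hI x hx
    have e5 : τ.mem 5 = σ.mem 5 := hU.mem 5 rfl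
    simp only [Prog.exec, Exp.eval, setReg_mem, setMem_mem, hτj, e5]
    by_cases h : σ.mem 5 x = σ.mem 5 j
    · exact ⟨j, by omega, by simp [h], h.symm⟩
    · obtain ⟨y, hy, hy'⟩ := hI x (by
        have : x ≠ j := by rintro rfl; exact h rfl
        omega)
      exact ⟨y, by omega, by simpa [h] using hy'⟩
  · intro j υ hj hU hυj hI x hx
    have e5 : υ.mem 5 = σ.mem 5 := by rw [hU.mem 5 rfl, hUτ.mem 5 rfl]
    have e7 : υ.mem 7 = τ.mem 7 := hU.mem 7 rfl
    simp only [Prog.exec, Exp.eval, Op.eval, setReg_mem, setMem_mem, hυj, e5, e7,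
      Nat.mod_eq_of_lt h1w]
    by_cases h : x = j
    · simp [h]
    · simp only [h, and_false, if_false]
      exact hI x (by omega)
  · intro υ hυ
    have hmark : ∀ x < n, υ.mem 3 x ≠ 0 ↔ τ.mem 7 (σ.mem 5 x) = x := by
      intro x hx
      rw [hυ x hx]
      simp
    constructor
    · intro x hx
      obtain ⟨y, hy, hy', hxy⟩ := hτ x hx
      exact ⟨y, hy, (hmark y hy).2 (by rw [hxy, hy']), hxy⟩
    · intro x hx y hy hx' hy' hxy
      rw [← (hmark x hx).1 hx', ← (hmark y hy).1 hy', hxy]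
  · simp [Prog.cost]
    omega

/-! ### Merging blocks -/

/-- `rho` maps every vertex below `n` to the representative of its block, `sz` maps every
representative to the size of its block, and `off` numbers the vertices of every block. -/
structure Blocks (n : ℕ) (rho off sz : ℕ → ℕ) : Prop where
  lt : ∀ x < n, rho x < n
  idem : ∀ x < n, rho (rho x) = rho x
  size : ∀ x < n, rho x = x → sz x = ((Finset.range n).filter fun z => rho z = x).card
  off_lt : ∀ x < n, off x < ((Finset.range n).filter fun z => rho z = rho x).card
  inj : ∀ x < n, ∀ y < n, rho x = rho y → off x = off y → x = y

/-- The number of vertices in blocks with label `d` and with representative below `u`. -/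
def numBefore (n : ℕ) (rho cl : ℕ → ℕ) (d u : ℕ) : ℕ :=
  ((Finset.range n).filter fun z => cl (rho z) = d ∧ rho z < u).card

theorem numBefore_le (n : ℕ) (rho cl : ℕ → ℕ) (d u : ℕ) : numBefore n rho cl d u ≤ n :=
  (Finset.card_filter_le _ _).trans_eq (Finset.card_range n)

theorem numBefore_mono (n : ℕ) (rho cl : ℕ → ℕ) (d : ℕ) {u v : ℕ} (h : u ≤ v) :
    numBefore n rho cl d u ≤ numBefore n rho cl d v := by
  refine Finset.card_le_card fun z hz => ?_
  simp only [Finset.mem_filter] at hz ⊢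
  exact ⟨hz.1, hz.2.1, by omega⟩

theorem numBefore_succ (n : ℕ) (rho cl : ℕ → ℕ) (d u : ℕ) :
    numBefore n rho cl d (u + 1) = numBefore n rho cl d u +
      if cl u = d then ((Finset.range n).filter fun z => rho z = u).card else 0 := by
  have h : ((Finset.range n).filter fun z => cl (rho z) = d ∧ rho z < u + 1) =
      ((Finset.range n).filter fun z => cl (rho z) = d ∧ rho z < u) ∪
        ((Finset.range n).filter fun z => rho z = u ∧ cl u = d) := by
    ext z
    simp only [Finset.mem_filter, Finset.mem_union, Finset.mem_range]
    constructor
    · rintro ⟨h1, h2, h3⟩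
      rcases Nat.lt_succ_iff_lt_or_eq.1 h3 with h | h
      · exact .inl ⟨h1, h2, h⟩
      · exact .inr ⟨h1, h, h ▸ h2⟩
    · rintro (⟨h1, h2, h3⟩ | ⟨h1, rfl, h3⟩)
      · exact ⟨h1, h2, by omega⟩
      · exact ⟨h1, h3, by omega⟩
  unfold numBefore
  rw [h, Finset.card_union_of_disjoint]
  · split_ifs with hd <;> simp [hd]
  · rw [Finset.disjoint_filter]
    rintro z _ ⟨_, h1⟩ ⟨h2, _⟩
    omega

/-- `rho'`, `off'` arise from the blocks `rho`, `off` by merging all blocks with the same label. -/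
structure Merged (n : ℕ) (cl rho off rho' off' sz' : ℕ → ℕ) : Prop where
  off_eq : ∀ x < n, off' x = off x + numBefore n rho cl (cl (rho x)) (rho x)
  size_eq : ∀ x < n, sz' x = numBefore n rho cl (cl x) n
  rep : ∀ x < n, rho' x < n ∧ rho (rho' x) = rho' x ∧ cl (rho' x) = cl (rho x)
  eq : ∀ x < n, ∀ y < n, cl (rho x) = cl (rho y) → rho' x = rho' y

theorem numBefore_self {n : ℕ} {rho : ℕ → ℕ} (h : ∀ x < n, rho x < n) (cl : ℕ → ℕ) (d : ℕ) :
    numBefore n rho cl d n = ((Finset.range n).filter fun z => cl (rho z) = d).card := by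
  unfold numBefore
  congr 1
  refine Finset.filter_congr fun z hz => ?_
  simp [h z (Finset.mem_range.1 hz)]

/-- Inside a merged block, the old block with representative `r` occupies the offsets from
`numBefore` at `r` up to, but excluding, `numBefore` at `r + 1`. -/
theorem Blocks.off_add_lt {n : ℕ} {rho off sz : ℕ → ℕ} (h : Blocks n rho off sz) (cl : ℕ → ℕ)
    {x : ℕ} (hx : x < n) : off x + numBefore n rho cl (cl (rho x)) (rho x) <
      numBefore n rho cl (cl (rho x)) (rho x + 1) := by
  rw [numBefore_succ, if_pos rfl]
  have := h.off_lt x hx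
  omega

/-- Offsets stay injective because distinct old blocks with the same label occupy disjoint intervals
of offsets. -/
theorem Merged.blocks {n : ℕ} {cl rho off sz rho' off' sz' : ℕ → ℕ}
    (hm : Merged n cl rho off rho' off' sz') (h : Blocks n rho off sz) :
    Blocks n rho' off' sz' := by
  have hiff : ∀ x < n, ∀ y < n, rho' x = rho' y ↔ cl (rho x) = cl (rho y) := fun x hx y hy =>
    ⟨fun h' => by rw [← (hm.rep x hx).2.2, h', (hm.rep y hy).2.2], hm.eq x hx y hy⟩
  have hcard : ∀ x < n, ((Finset.range n).filter fun z => rho' z = rho' x).card =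
      numBefore n rho cl (cl (rho x)) n := by
    intro x hx
    rw [numBefore_self h.lt]
    congr 1
    exact Finset.filter_congr fun z hz => hiff z (Finset.mem_range.1 hz) x hx
  refine ⟨fun x hx => (hm.rep x hx).1, ?_, ?_, ?_, ?_⟩
  · intro x hx
    obtain ⟨h1, h2, h3⟩ := hm.rep x hx
    exact hm.eq _ h1 _ hx (by rw [h2, h3])
  · intro x hx hxx
    obtain ⟨h1, h2, h3⟩ := hm.rep x hx
    have := hcard x hx
    rw [hxx] at this h3
    rw [hm.size_eq x hx, this, h3]
  · intro x hx
    rw [hcard x hx, hm.off_eq x hx]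
    exact (h.off_add_lt cl hx).trans_le (numBefore_mono _ _ _ _ (h.lt x hx))
  · intro x hx y hy hxy ho
    have hc := (hiff x hx y hy).1 hxy
    rw [hm.off_eq x hx, hm.off_eq y hy] at ho
    have h1 := h.off_add_lt cl hx
    have h2 := h.off_add_lt cl hy
    rw [hc] at ho h1
    rcases lt_trichotomy (rho x) (rho y) with hlt | heq | hlt
    · have := numBefore_mono n rho cl (cl (rho y)) (show _ + 1 ≤ _ from hlt)
      omega
    · rw [heq] at ho
      exact h.inj x hx y hy heq (by omega)
    · have := numBefore_mono n rho cl (cl (rho y)) (show _ + 1 ≤ _ from hlt)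
      omega

/-- Merge the blocks given by the banks `10`, `11`, `12` according to the labels in bank `5`. -/
def merge : Prog :=
  .seq (forLoop 5 (.lit 0) (.reg 0) (.seq (.store 8 (.read 5 (.reg 5)) (.lit 0))
      (.store 7 (.read 5 (.read 10 (.reg 5))) (.read 10 (.reg 5)))))
    (.seq (forLoop 5 (.lit 0) (.reg 0) (.cond (.bin .eq (.read 10 (.reg 5)) (.reg 5))
        (.seq (.store 9 (.reg 5) (.read 8 (.read 5 (.reg 5))))
          (.store 8 (.read 5 (.reg 5)) (.bin .add (.read 8 (.read 5 (.reg 5))) (.read 12 (.reg 5)))))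
        .skip))
      (forLoop 5 (.lit 0) (.reg 0)
        (.seq (.store 11 (.reg 5) (.bin .add (.read 11 (.reg 5)) (.read 9 (.read 10 (.reg 5)))))
          (.seq (.store 12 (.reg 5) (.read 8 (.read 5 (.reg 5))))
            (.store 10 (.reg 5) (.read 7 (.read 5 (.read 10 (.reg 5)))))))))

/-- The first pass resets the counter of each label and chooses its representative. The second pass
sums block sizes per label and saves the partial sum at each old representative. The third pass
updates the blocks. -/
theorem merge_spec {n : ℕ} {σ : Store} (hn : σ.reg 0 = n) (hw : n + 1 < 2 ^ w)
    (hB : Blocks n (σ.mem 10) (σ.mem 11) (σ.mem 12)) :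
    Terminates w merge (n * 24 + 11) σ (fun τ =>
      Merged n (σ.mem 5) (σ.mem 10) (σ.mem 11) (τ.mem 10) (τ.mem 11) (τ.mem 12)) := by
  have h1w : 1 < 2 ^ w := by omega
  set cl := σ.mem 5 with hcl
  set rho := σ.mem 10 with hrho
  set off := σ.mem 11 with hoff
  set sz := σ.mem 12 with hsz
  let I₁ : ℕ → Store → Prop := fun j τ => (∀ x < j, τ.mem 8 (cl x) = 0) ∧
    ∀ x < j, τ.mem 7 (cl (rho x)) < n ∧ rho (τ.mem 7 (cl (rho x))) = τ.mem 7 (cl (rho x)) ∧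
      cl (τ.mem 7 (cl (rho x))) = cl (rho x)
  let I₂ : ℕ → Store → Prop := fun j τ =>
    (∀ x < n, τ.mem 8 (cl x) = numBefore n rho cl (cl x) j) ∧
    ∀ x < j, rho x = x → τ.mem 9 x = numBefore n rho cl (cl x) x
  let I₃ : (ℕ → ℕ) → ℕ → Store → Prop := fun rep j τ =>
    (∀ x < j, τ.mem 11 x = off x + numBefore n rho cl (cl (rho x)) (rho x)) ∧
    (∀ x < j, τ.mem 12 x = numBefore n rho cl (cl x) n) ∧
    (∀ x < j, τ.mem 10 x = rep (cl (rho x))) ∧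
    ∀ x, j ≤ x → τ.mem 10 x = rho x ∧ τ.mem 11 x = off x
  unfold merge
  refine Terminates.mono (.seq_frame (Prog.Straight.forLoop (w := w) (n := n) (by simp [Prog.Straight]) I₁
      hn (by omega) rfl rfl (by simp [I₁]) ?_) fun τ hτ hUτ =>
    .seq_frame (Prog.Straight.forLoop (w := w) (n := n) (by simp [Prog.Straight]) I₂
      (by rw [hUτ.reg 0 rfl, hn]) (by omega) rfl rfl ?_ ?_) fun υ hυ hUυ =>
    Terminates.mono (Prog.Straight.forLoop (w := w) (n := n) (by simp [Prog.Straight]) (I₃ (τ.mem 7))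
      (by rw [hUυ.reg 0 rfl, hUτ.reg 0 rfl, hn]) (by omega) rfl rfl ?_ ?_) le_rfl ?_)
    ?_ (fun _ h => h)
  · rintro j τ hj hU hτj ⟨I1, I2⟩
    have e5 : τ.mem 5 = cl := hU.mem 5 rfl
    have e10 : τ.mem 10 = rho := hU.mem 10 rfl
    have E8 : ∀ d, ((Prog.exec w (.seq (.store 8 (.read 5 (.reg 5)) (.lit 0))
        (.store 7 (.read 5 (.read 10 (.reg 5))) (.read 10 (.reg 5)))) τ).setReg 5 (j + 1)).mem 8 d =
        if d = cl j then 0 else τ.mem 8 d := by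
      simp [Prog.exec, Exp.eval, setMem_mem, hτj, e5]
    have E7 : ∀ d, ((Prog.exec w (.seq (.store 8 (.read 5 (.reg 5)) (.lit 0))
        (.store 7 (.read 5 (.read 10 (.reg 5))) (.read 10 (.reg 5)))) τ).setReg 5 (j + 1)).mem 7 d =
        if d = cl (rho j) then rho j else τ.mem 7 d := by
      simp [Prog.exec, Exp.eval, setMem_mem, hτj, e5, e10]
    constructor
    · intro x hx
      rw [E8]
      split_ifs with h
      · rfl
      · exact I1 x (by
          have : x ≠ j := by rintro rfl; exact h rfl
          omega)
    · intro x hx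
      rw [E7]
      split_ifs with h
      · exact ⟨hB.lt j hj, hB.idem j hj, h.symm⟩
      · exact I2 x (by
          have : x ≠ j := by rintro rfl; exact h rfl
          omega)
  · refine ⟨fun x hx => ?_, by simp⟩
    simp [hτ.1 x hx, numBefore]
  · rintro j υ hj hU hυj ⟨I1, I2⟩
    have e5 : υ.mem 5 = cl := by rw [hU.mem 5 rfl, hUτ.mem 5 rfl]
    have e10 : υ.mem 10 = rho := by rw [hU.mem 10 rfl, hUτ.mem 10 rfl]
    have e12 : υ.mem 12 = sz := by rw [hU.mem 12 rfl, hUτ.mem 12 rfl]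
    by_cases hfix : rho j = j
    · have hadd : υ.mem 8 (cl j) + sz j = numBefore n rho cl (cl j) (j + 1) := by
        rw [numBefore_succ, if_pos rfl, I1 j hj, hB.size j hj hfix]
      have hmod : (υ.mem 8 (cl j) + sz j) % 2 ^ w = numBefore n rho cl (cl j) (j + 1) := by
        rw [hadd]
        exact Nat.mod_eq_of_lt (by have := numBefore_le n rho cl (cl j) (j + 1); omega)
      simp [I₂, Prog.exec, Exp.eval, Op.eval, setMem_mem, hυj, e5, e10, e12, hfix,
        Nat.mod_eq_of_lt h1w, hmod]
      constructor
      · intro x hx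
        split_ifs with h
        · rw [h]
        · rw [I1 x hx, numBefore_succ, if_neg (Ne.symm h), add_zero]
      · intro x hx hxx
        split_ifs with h
        · rw [h, I1 j hj]
        · exact I2 x (by omega) hxx
    · have hempty : ((Finset.range n).filter fun z => rho z = j).card = 0 := by
        rw [Finset.card_eq_zero, Finset.filter_eq_empty_iff]
        intro z hz hzj
        exact hfix (by rw [← hzj, hB.idem z (Finset.mem_range.1 hz)])
      simp [I₂, Prog.exec, Exp.eval, Op.eval, hυj, e10, hfix]
      constructor
      · intro x hx
        rw [I1 x hx, numBefore_succ, hempty]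
        simp
      · intro x hx hxx
        refine I2 x ?_ hxx
        have : x ≠ j := by rintro rfl; exact hfix hxx
        omega
  · refine ⟨by simp, by simp, by simp, fun x _ => ⟨?_, ?_⟩⟩
    · rw [setReg_mem, hUυ.mem 10 rfl, hUτ.mem 10 rfl]
    · rw [setReg_mem, hUυ.mem 11 rfl, hUτ.mem 11 rfl]
  · rintro j θ hj hU hθj ⟨I1, I2, I3, I4⟩
    have e5 : θ.mem 5 = cl := by rw [hU.mem 5 rfl, hUυ.mem 5 rfl, hUτ.mem 5 rfl]
    have e7 : θ.mem 7 = τ.mem 7 := by rw [hU.mem 7 rfl, hUυ.mem 7 rfl]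
    have e8 : θ.mem 8 = υ.mem 8 := hU.mem 8 rfl
    have e9 : θ.mem 9 = υ.mem 9 := hU.mem 9 rfl
    -- Banks `10` and `11` are overwritten in place; this is safe because iteration `j` reads them
    -- only at index `j`.
    obtain ⟨e10, e11⟩ := I4 j le_rfl
    have e9' : υ.mem 9 (rho j) = numBefore n rho cl (cl (rho j)) (rho j) :=
      hυ.2 _ (hB.lt j hj) (hB.idem j hj)
    have hmod : (off j + numBefore n rho cl (cl (rho j)) (rho j)) % 2 ^ w =
        off j + numBefore n rho cl (cl (rho j)) (rho j) := by
      have := hB.off_add_lt cl hj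
      have := numBefore_le n rho cl (cl (rho j)) (rho j + 1)
      exact Nat.mod_eq_of_lt (by omega)
    simp [I₃, Prog.exec, Exp.eval, Op.eval, setMem_mem, hθj, e5, e7, e8, e9, e10, e11, e9', hmod]
    refine ⟨?_, ?_, ?_, ?_⟩
    · intro x hx
      split_ifs with h
      · rw [h]
      · exact I1 x (by omega)
    · intro x hx
      split_ifs with h
      · rw [h, hυ.1 j hj]
      · exact I2 x (by omega)
    · intro x hx
      split_ifs with h
      · rw [h]
      · exact I3 x (by omega)
    · intro x hx
      rw [if_neg (by omega), if_neg (by omega)]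
      exact I4 x (by omega)
  · rintro θ ⟨I1, I2, I3, _⟩
    refine ⟨I1, I2, fun x hx => ?_, fun x hx y hy h => ?_⟩
    · rw [I3 x hx]
      exact hτ.2 x hx
    · rw [I3 x hx, I3 y hy, h]
  · simp [Prog.cost]
    omega

end WordRAM

namespace WordRAM

variable {w : ℕ} {S : Set Store}

/-! ### Random sampling -/

/-- The average of `F` over all sequences of `k` numbers below `r`. -/
noncomputable def avg (r : ℕ) : ℕ → (List ℕ → ENNReal) → ENNReal
  | 0, F => F []
  | k + 1, F => (∑ x ∈ Finset.range r, avg r k fun ω => F (x :: ω)) / r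

theorem avg_mono {r k : ℕ} {F G : List ℕ → ENNReal}
    (h : ∀ ω, ω.length = k → (∀ x ∈ ω, x < r) → F ω ≤ G ω) : avg r k F ≤ avg r k G := by
  induction k generalizing F G with
  | zero => exact h [] rfl (by simp)
  | succ k ih =>
    refine ENNReal.div_le_div_right (Finset.sum_le_sum fun x hx => ih fun ω hω hω' => ?_) _
    refine h _ (by simp [hω]) fun y hy => ?_
    rcases List.mem_cons.1 hy with rfl | hy
    · exact Finset.mem_range.1 hx
    · exact hω' y hy

theorem avg_const {r : ℕ} (hr : 0 < r) (k : ℕ) (b : ENNReal) : avg r k (fun _ => b) = b := by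
  induction k with
  | zero => rfl
  | succ k ih =>
    have : (r : ENNReal) ≠ 0 := by exact_mod_cast hr.ne'
    simp only [avg, ih, Finset.sum_const, Finset.card_range, nsmul_eq_mul]
    rw [mul_comm, ENNReal.mul_div_cancel_right this (ENNReal.natCast_ne_top r)]

theorem avg_add (r k : ℕ) (F G : List ℕ → ENNReal) :
    avg r k (fun ω => F ω + G ω) = avg r k F + avg r k G := by
  induction k generalizing F G with
  | zero => rfl
  | succ k ih => simp only [avg, ih, Finset.sum_add_distrib, ENNReal.add_div]

theorem avg_sum {ι : Type*} (r k : ℕ) (s : Finset ι) (F : ι → List ℕ → ENNReal) :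
    avg r k (fun ω => ∑ i ∈ s, F i ω) = ∑ i ∈ s, avg r k (F i) := by
  classical
  induction s using Finset.induction_on with
  | empty =>
    simp only [Finset.sum_empty]
    induction k with
    | zero => rfl
    | succ k ih => simp [avg, ih]
  | insert a s ha ih => simp only [Finset.sum_insert ha, avg_add, ih]

theorem avg_avoid {r : ℕ} (D : Finset ℕ) (hD : D ⊆ Finset.range r) (k : ℕ) :
    avg r k (fun ω => if ∀ x ∈ ω, x ∉ D then 1 else 0) = (((r - D.card : ℕ) : ENNReal) / r) ^ k := by
  induction k with
  | zero => simp [avg]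
  | succ k ih =>
    have h : ∀ x, avg r k (fun ω => if ∀ y ∈ x :: ω, y ∉ D then 1 else 0) =
        if x ∉ D then (((r - D.card : ℕ) : ENNReal) / r) ^ k else 0 := by
      intro x
      by_cases hx : x ∈ D
      · simp only [List.mem_cons, forall_eq_or_imp, hx, not_true_eq_false, false_and, if_false]
        -- The average of zero, as an empty sum; `avg_const` would require `0 < r`.
        exact (avg_sum r k (∅ : Finset ℕ) (fun _ _ => 0)).trans (by simp)
      · simp [hx, ih]
    simp only [avg, h]
    rw [← Finset.sum_filter, Finset.sum_const, nsmul_eq_mul, pow_succ', ENNReal.mul_div_right_comm]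
    congr 3
    rw [Finset.filter_notMem_eq_sdiff, Finset.card_sdiff_of_subset hD, Finset.card_range]

/-- A random sequence is unlikely to avoid one of finitely many large sets. -/
theorem avg_exists_avoid_le {ι : Type*} {r : ℕ} (hr : 0 < r) (s : Finset ι) (D : ι → Finset ℕ)
    (hD : ∀ i ∈ s, D i ⊆ Finset.range r) (k : ℕ) {δ : ℝ} (hδ : ∀ i ∈ s, δ ≤ (D i).card) :
    avg r k (fun ω => ⨆ (_ : ∃ i ∈ s, ∀ x ∈ ω, x ∉ D i), 1) ≤
      ENNReal.ofReal (s.card * Real.exp (-(δ * k / r))) := by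
  -- Union bound. The supremum over a proposition is its indicator.
  have h1 : avg r k (fun ω => ⨆ (_ : ∃ i ∈ s, ∀ x ∈ ω, x ∉ D i), 1) ≤
      ∑ i ∈ s, avg r k (fun ω => if ∀ x ∈ ω, x ∉ D i then 1 else 0) := by
    rw [← avg_sum]
    refine avg_mono fun ω _ _ => iSup_le fun ⟨i, hi, h⟩ => ?_
    refine le_trans ?_ (Finset.single_le_sum (fun _ _ => zero_le) hi)
    rw [if_pos h]
  refine h1.trans ?_
  have hr' : (0 : ℝ) < r := by exact_mod_cast hr
  have h2 : ∀ i ∈ s, avg r k (fun ω => if ∀ x ∈ ω, x ∉ D i then 1 else 0) ≤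
      ENNReal.ofReal (Real.exp (-(δ * k / r))) := by
    intro i hi
    have hc : (D i).card ≤ r := by simpa using Finset.card_le_card (hD i hi)
    rw [avg_avoid _ (hD i hi), ← ENNReal.ofReal_natCast, ← ENNReal.ofReal_natCast r,
      ← ENNReal.ofReal_div_of_pos hr', ← ENNReal.ofReal_pow (by positivity)]
    refine ENNReal.ofReal_le_ofReal ?_
    have h3 : ((r - (D i).card : ℕ) : ℝ) / r ≤ Real.exp (-(δ / r)) := by
      have h4 := Real.add_one_le_exp (-(δ / r))
      refine le_trans ?_ h4
      rw [Nat.cast_sub hc, sub_div, div_self hr'.ne']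
      have := div_le_div_of_nonneg_right (hδ i hi) hr'.le
      linarith
    calc (((r - (D i).card : ℕ) : ℝ) / r) ^ k ≤ Real.exp (-(δ / r)) ^ k := by gcongr
      _ = Real.exp (-(δ * k / r)) := by
        rw [← Real.exp_nat_mul]
        congr 1
        ring
  refine (Finset.sum_le_sum h2).trans ?_
  rw [Finset.sum_const, nsmul_eq_mul, ENNReal.ofReal_mul (by positivity), ENNReal.ofReal_natCast]

/-- Mark, in bank `3`, as many random elements of the list in bank `4` as register `3` says. -/
def draw : Prog :=
  forLoop 5 (.lit 0) (.reg 3) (.seq (.rand 6 (.reg 4)) (.store 3 (.read 4 (.reg 6)) (.lit 1)))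

/-- The failure bound `F` of the continuation may depend on the whole sample; the recursion of `avg`
mirrors the loop, one choice per iteration. -/
theorem draw_safe {σ : Store} {k r s : ℕ} {l : List Prog} (hk : σ.reg 3 = k) (hr : σ.reg 4 = r)
    (hr0 : 0 < r) (hw : k < 2 ^ w) (hw1 : 1 < 2 ^ w) (F : List ℕ → ENNReal)
    (h : ∀ ω : List ℕ, ω.length = k → (∀ i ∈ ω, i < r) → ∀ τ, Unchanged draw σ τ →
      (∀ x, τ.mem 3 x ≠ 0 ↔ (∃ i ∈ ω, σ.mem 4 i = x) ∨ σ.mem 3 x ≠ 0) →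
      Safe w S s (F ω) ⟨l, τ⟩) :
    Safe w S (s + 6 * k + 3) (avg r k F) ⟨draw :: l, σ⟩ := by
  set body : Prog := .seq (.rand 6 (.reg 4)) (.store 3 (.read 4 (.reg 6)) (.lit 1)) with hbody
  -- Induction on the number `i` of iterations left, with `F` arbitrary because a draw turns it into
  -- `fun ω => F (x :: ω)`.
  have h1 : ∀ (i : ℕ) (F : List ℕ → ENNReal) (σ : Store), σ.reg 3 = k → σ.reg 4 = r →
      i ≤ k → σ.reg 5 + i = k →
      (∀ ω : List ℕ, ω.length = i → (∀ i ∈ ω, i < r) → ∀ τ, Unchanged draw σ τ →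
        (∀ x, τ.mem 3 x ≠ 0 ↔ (∃ i ∈ ω, σ.mem 4 i = x) ∨ σ.mem 3 x ≠ 0) →
        Safe w S s (F ω) ⟨l, τ⟩) →
      Safe w S (s + 6 * i + 1) (avg r i F) ⟨.loop (.bin .lt (.reg 5) (.reg 3))
        (.seq body (.assign 5 (.bin .add (.reg 5) (.lit 1)))) :: l, σ⟩ := by
    intro i
    induction i with
    | zero =>
      intro F σ hk hr _ h5 h
      refine Safe.of_step_pure ?_ (h [] rfl (by simp) σ (.refl _ _) (by simp))
      have : ¬ σ.reg 5 < σ.reg 3 := by omega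
      rw [step, if_neg]
      simp [Exp.eval, Op.eval, this]
    | succ i ih =>
      intro F σ hk hr hi h5 h
      have e : s + 6 * (i + 1) + 1 = (((((s + 6 * i + 1) + 1 + 1) + 1) + 1) + 1) + 1 := by ring
      rw [e]
      refine Safe.of_step_pure (D := ⟨.seq body (.assign 5 (.bin .add (.reg 5) (.lit 1))) :: .loop
        (.bin .lt (.reg 5) (.reg 3)) (.seq body (.assign 5 (.bin .add (.reg 5) (.lit 1)))) :: l,
        σ⟩) ?_ (Safe.of_step_pure rfl (Safe.of_step_pure rfl (Safe.rand hr hr0 fun x hx =>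
          Safe.of_step_pure rfl (Safe.of_step_pure rfl (ih _ _ ?_ ?_ (by omega) ?_ ?_)))))
      · have : σ.reg 5 < σ.reg 3 := by omega
        rw [step, if_pos]
        simp [Exp.eval, Op.eval, this, Nat.mod_eq_of_lt hw1]
      · simpa [setReg_reg] using hk
      · simpa [setReg_reg] using hr
      · simp only [Exp.eval, Op.eval, setReg_reg, setMem_reg, Nat.mod_eq_of_lt hw1]
        simp only [if_true]
        simp
        rw [Nat.mod_eq_of_lt (by omega)]
        omega
      · intro ω hω hω' τ hU hτ
        refine h (x :: ω) (by simp [hω]) ?_ τ ?_ ?_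
        · intro j hj
          rcases List.mem_cons.1 hj with rfl | hj
          · exact hx
          · exact hω' j hj
        · refine Unchanged.trans ⟨fun a ha => ?_, fun a ha => ?_⟩ hU
          · simp [draw, WordRAM.forLoop, Prog.writesReg] at ha
            rw [setReg_reg, if_neg (by omega), setMem_reg, setReg_reg, if_neg (by omega)]
          · simp [draw, WordRAM.forLoop, Prog.writesMem] at ha
            funext d
            rw [setReg_mem, setMem_mem, if_neg (by omega), setReg_mem]
        · intro y
          rw [hτ y]
          simp only [Exp.eval, setReg_mem, setMem_mem, setReg_reg, Nat.mod_eq_of_lt hw1]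
          by_cases hy : y = σ.mem 4 x
          · simp [hy]
          · simp [hy, Ne.symm hy]
  refine Safe.of_step_pure (t := s + 6 * k + 2) rfl (Safe.of_step_pure rfl
    (h1 k F _ ?_ ?_ le_rfl ?_ fun ω hω hω' τ hU hτ => h ω hω hω' τ ?_ hτ))
  · simpa [setReg_reg] using hk
  · simpa [setReg_reg] using hr
  · simp [setReg_reg, Exp.eval]
  · refine Unchanged.trans (τ := σ.setReg 5 (Exp.eval w σ (.lit 0)))
      ⟨fun a ha => ?_, fun a ha => rfl⟩ hU
    simp [draw, WordRAM.forLoop, Prog.writesReg] at ha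
    rw [setReg_reg, if_neg (by omega)]

end WordRAM

namespace WordRAM

/-! ### Crossings of blocks -/

/-- The number of pairs of consecutive vertices, with respect to `pos`, such that exactly one of
their representatives is a neighbor of `v`. -/
def blockCrossings (n : ℕ) (nbr : ℕ → List ℕ) (pos rho : ℕ → ℕ) (v : ℕ) : ℕ :=
  ((Finset.range n ×ˢ Finset.range n).filter fun p =>
    pos p.2 = pos p.1 + 1 ∧ ¬ (rho p.1 ∈ nbr v ↔ rho p.2 ∈ nbr v)).card

/-- The representatives of the blocks. -/
def reps (n : ℕ) (rho : ℕ → ℕ) : Finset ℕ := (Finset.range n).filter fun r => rho r = r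

/-- The representatives that are adjacent to exactly one of `u` and `v`. -/
def distinguishing (n : ℕ) (nbr : ℕ → List ℕ) (rho : ℕ → ℕ) (u v : ℕ) : Finset ℕ :=
  (reps n rho).filter fun r => ¬ (r ∈ nbr u ↔ r ∈ nbr v)

/-- `pos` numbers the vertices injectively and such that all blocks are intervals. -/
structure Extends (n : ℕ) (rho off pos : ℕ → ℕ) : Prop where
  shift : ∃ b : ℕ → ℕ, ∀ x < n, pos x = off x + b (rho x)
  inj : ∀ x < n, ∀ y < n, pos x = pos y → x = y

/-- If the numbering of the vertices extends the blocks, then replacing the vertices by their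
representatives changes the maximal number of crossings by at most `β`. -/
def Budget (n : ℕ) (nbr : ℕ → List ℕ) (rho off : ℕ → ℕ) (β : ℝ) : Prop :=
  ∀ pos, Extends n rho off pos → ∀ M : ℝ, (∀ v < n, (blockCrossings n nbr pos rho v : ℝ) ≤ M) →
    ∀ v < n, (blockCrossings n nbr pos id v : ℝ) ≤ M + β

variable {n : ℕ} {nbr : ℕ → List ℕ} {cl rho off sz rho' off' sz' pos : ℕ → ℕ}

/-! ### Blocks as intervals of a numbering, and the cost of a merge. -/

theorem Blocks.exists_off_eq (h : Blocks n rho off sz) {r s : ℕ}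
    (hs : s < ((Finset.range n).filter fun z => rho z = r).card) :
    ∃ z < n, rho z = r ∧ off z = s := by
  have := Finset.surjOn_of_injOn_of_card_le (s := (Finset.range n).filter fun z => rho z = r)
    (t := Finset.range ((Finset.range n).filter fun z => rho z = r).card) off ?_ ?_ (by simp)
  · obtain ⟨z, hz, hzs⟩ := this (Finset.mem_coe.2 (Finset.mem_range.2 hs))
    simp only [Finset.coe_filter, Finset.mem_range, Set.mem_ofPred_eq] at hz
    exact ⟨z, hz.1, hz.2, hzs⟩
  · intro z hz
    simp only [Finset.coe_filter, Finset.mem_range, Set.mem_ofPred_eq] at hz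
    obtain ⟨hz, rfl⟩ := hz
    simpa using h.off_lt z hz
  · intro x hx y hy hxy
    simp only [Finset.coe_filter, Finset.mem_range, Set.mem_ofPred_eq] at hx hy
    exact h.inj x hx.1 y hy.1 (by rw [hx.2, hy.2]) hxy

/-- A block is an interval, so the numbering leaves it at most once (`hL`) and enters it at most
once (`hR`). -/
theorem Blocks.card_boundary_le (h : Blocks n rho off sz) (hpos : Extends n rho off pos)
    (D : Finset ℕ) : ((Finset.range n ×ˢ Finset.range n).filter fun p : ℕ × ℕ =>
      pos p.2 = pos p.1 + 1 ∧ rho p.1 ≠ rho p.2 ∧ (rho p.1 ∈ D ∨ rho p.2 ∈ D)).card ≤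
      2 * D.card := by
  obtain ⟨⟨b, hb⟩, hinj⟩ := hpos
  have hL : ((Finset.range n ×ˢ Finset.range n).filter fun p : ℕ × ℕ =>
      pos p.2 = pos p.1 + 1 ∧ rho p.1 ≠ rho p.2 ∧ rho p.1 ∈ D).card ≤ D.card := by
    refine Finset.card_le_card_of_injOn (fun p => rho p.1) (fun p hp => ?_) ?_
    · exact (Finset.mem_filter.1 hp).2.2.2
    · have key : ∀ x < n, ∀ x' < n, ∀ y < n, rho x = rho x' → pos y = pos x + 1 → rho x ≠ rho y →
          ¬ off x < off x' := by
        intro x hx x' hx' y hy hr hp hne hlt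
        obtain ⟨z, hz, hzr, hzo⟩ := h.exists_off_eq (r := rho x) (s := off x + 1) (by
          have := h.off_lt x' hx'
          rw [← hr] at this
          omega)
        have := hinj z hz y hy (by rw [hp, hb z hz, hb x hx, hzr, hzo]; omega)
        exact hne (by rw [← this, hzr])
      rintro ⟨x, y⟩ hp ⟨x', y'⟩ hp' hr
      simp only [Finset.coe_filter, Finset.mem_product, Finset.mem_range, Set.mem_ofPred_eq]
        at hp hp' hr
      obtain ⟨⟨hx, hy⟩, hxy, hne, -⟩ := hp
      obtain ⟨⟨hx', hy'⟩, hxy', hne', -⟩ := hp'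
      have h1 := key x hx x' hx' y hy hr hxy hne
      have h2 := key x' hx' x hx y' hy' hr.symm hxy' hne'
      have h3 := h.inj x hx x' hx' hr (by omega)
      subst h3
      rw [hinj y hy y' hy' (by rw [hxy, hxy'])]
  have hR : ((Finset.range n ×ˢ Finset.range n).filter fun p : ℕ × ℕ =>
      pos p.2 = pos p.1 + 1 ∧ rho p.1 ≠ rho p.2 ∧ rho p.2 ∈ D).card ≤ D.card := by
    refine Finset.card_le_card_of_injOn (fun p => rho p.2) (fun p hp => ?_) ?_
    · exact (Finset.mem_filter.1 hp).2.2.2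
    · have key : ∀ y < n, ∀ y' < n, ∀ x' < n, rho y = rho y' → pos y' = pos x' + 1 →
          rho x' ≠ rho y' → ¬ off y < off y' := by
        intro y hy y' hy' x' hx' hr hp hne hlt
        obtain ⟨z, hz, hzr, hzo⟩ := h.exists_off_eq (r := rho y') (s := off y' - 1) (by
          have := h.off_lt y' hy'
          omega)
        have := hinj z hz x' hx' (by
          have h1 := hb z hz
          have h2 := hb y' hy'
          rw [hzr, hzo] at h1
          omega)
        exact hne (by rw [← this, hzr])
      rintro ⟨x, y⟩ hp ⟨x', y'⟩ hp' hr
      simp only [Finset.coe_filter, Finset.mem_product, Finset.mem_range, Set.mem_ofPred_eq]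
        at hp hp' hr
      obtain ⟨⟨hx, hy⟩, hxy, hne, -⟩ := hp
      obtain ⟨⟨hx', hy'⟩, hxy', hne', -⟩ := hp'
      have h1 := key y hy y' hy' x' hx' hr hxy' hne'
      have h2 := key y' hy' y hy x hx hr.symm hxy hne
      have h3 := h.inj y hy y' hy' hr (by omega)
      subst h3
      rw [hinj x hx x' hx' (by omega)]
  refine le_trans (Finset.card_le_card ?_) ((Finset.card_union_le _ _).trans
    (by rw [two_mul]; exact Nat.add_le_add hL hR))
  intro p hp
  simp only [Finset.mem_filter, Finset.mem_union] at hp ⊢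
  tauto

theorem Blocks.rho_mem_reps (h : Blocks n rho off sz) {x : ℕ} (hx : x < n) :
    rho x ∈ reps n rho :=
  Finset.mem_filter.2 ⟨Finset.mem_range.2 (h.lt x hx), h.idem x hx⟩

/-- A pair that crosses for `u` but not for `v` lies on the boundary of a block whose representative
distinguishes `u` from `v`. -/
theorem Blocks.blockCrossings_le_add (h : Blocks n rho off sz) (hpos : Extends n rho off pos)
    (u v : ℕ) : blockCrossings n nbr pos rho u ≤
      blockCrossings n nbr pos rho v + 2 * (distinguishing n nbr rho u v).card := by
  refine le_trans (Finset.card_le_card ?_) ((Finset.card_union_le _ _).trans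
    (Nat.add_le_add le_rfl (h.card_boundary_le hpos (distinguishing n nbr rho u v))))
  rintro ⟨x, y⟩ hp
  simp only [Finset.mem_filter, Finset.mem_union, Finset.mem_product, Finset.mem_range] at hp ⊢
  obtain ⟨⟨hx, hy⟩, hxy, hne⟩ := hp
  by_cases hv : rho x ∈ nbr v ↔ rho y ∈ nbr v
  · refine .inr ⟨⟨hx, hy⟩, hxy, fun he => hne (by rw [he]), ?_⟩
    simp only [distinguishing, Finset.mem_filter, h.rho_mem_reps hx, h.rho_mem_reps hy, true_and]
    tauto
  · exact .inl ⟨⟨hx, hy⟩, hxy, hv⟩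

theorem Blocks.blockCrossings_le (h : Blocks n rho off sz) (hpos : Extends n rho off pos)
    (v : ℕ) : blockCrossings n nbr pos rho v ≤ 2 * (reps n rho).card := by
  refine le_trans (Finset.card_le_card ?_) (h.card_boundary_le hpos (reps n rho))
  rintro ⟨x, y⟩ hp
  simp only [Finset.mem_filter, Finset.mem_product, Finset.mem_range] at hp ⊢
  obtain ⟨⟨hx, hy⟩, hxy, hne⟩ := hp
  exact ⟨⟨hx, hy⟩, hxy, fun he => hne (by rw [he]), .inl (h.rho_mem_reps hx)⟩

/-- Inside a merged block each old block is shifted by a constant, so the old blocks are intervals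
too. This lets budgets be composed over the rounds. -/
theorem Merged.extends (hm : Merged n cl rho off rho' off' sz') (h : Blocks n rho off sz)
    (hpos : Extends n rho' off' pos) : Extends n rho off pos := by
  obtain ⟨⟨b, hb⟩, hinj⟩ := hpos
  refine ⟨⟨fun r => numBefore n rho cl (cl r) r + b (rho' r), fun x hx => ?_⟩, hinj⟩
  change _ = off x + (numBefore n rho cl (cl (rho x)) (rho x) + b (rho' (rho x)))
  rw [hb x hx, hm.off_eq x hx, hm.eq (rho x) (h.lt x hx) x hx (by rw [h.idem x hx]), add_assoc]

theorem Budget.of_fixed (n : ℕ) (nbr : ℕ → List ℕ) (off : ℕ → ℕ) (hrho : ∀ x < n, rho x = x) :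
    Budget n nbr rho off 0 := by
  intro pos _ M hM v hv
  rw [add_zero]
  convert hM v hv using 2
  unfold blockCrossings
  congr 1
  refine Finset.filter_congr fun p hp => ?_
  simp only [Finset.mem_product, Finset.mem_range] at hp
  rw [hrho _ hp.1, hrho _ hp.2, id, id]

/-- Passing from `v` to `v'` costs `2 * δ` with the old representatives; for `v'`, old and new
representatives give the same crossings, to which the bound `M` applies. -/
theorem Budget.merge {β δ : ℝ} (hB : Budget n nbr rho off β) (h : Blocks n rho off sz)
    (hm : Merged n cl rho off rho' off' sz')
    (hv : ∀ v < n, ∃ v' < n, ((distinguishing n nbr rho v v').card : ℝ) ≤ δ ∧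
      ∀ x < n, rho' x ∈ nbr v' ↔ rho x ∈ nbr v') :
    Budget n nbr rho' off' (β + 2 * δ) := by
  intro pos hpos M hM v hvn
  have hpos' := hm.extends h hpos
  have := hB pos hpos' (M + 2 * δ) (fun u hu => ?_) v hvn
  · linarith
  · obtain ⟨u', hu', hδ, hx⟩ := hv u hu
    have h1 := h.blockCrossings_le_add (nbr := nbr) hpos' u u'
    have h2 : blockCrossings n nbr pos rho u' = blockCrossings n nbr pos rho' u' := by
      unfold blockCrossings
      congr 1
      refine Finset.filter_congr fun p hp => ?_
      simp only [Finset.mem_product, Finset.mem_range] at hp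
      rw [hx _ hp.1, hx _ hp.2]
    have h3 := hM u' hu'
    rw [h2] at h1
    have h4 : (blockCrossings n nbr pos rho u : ℝ) ≤ blockCrossings n nbr pos rho' u' +
        2 * (distinguishing n nbr rho u u').card := by exact_mod_cast h1
    linarith

end WordRAM

namespace WordRAM

variable {w n : ℕ} {nbr : ℕ → List ℕ}

/-! ### Rounds -/

/-- The lists `nbr 0, …, nbr (n - 1)` are adjacency lists of a graph on the vertices
`0, …, n - 1`. -/
structure IsGraph (n : ℕ) (nbr : ℕ → List ℕ) : Prop where
  nodup : ∀ v < n, (nbr v).Nodup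
  lt : ∀ v < n, ∀ x ∈ nbr v, x < n
  symm : ∀ u < n, ∀ v < n, u ∈ nbr v → v ∈ nbr u

/-- Vertices with different traces on a set of at most `k` vertices are at most `c * k` many. -/
def FewTraces (n : ℕ) (nbr : ℕ → List ℕ) (c : ℝ) : Prop :=
  ∀ (k : ℕ) (A S : Finset ℕ), 1 ≤ k → A.card ≤ k → A ⊆ Finset.range n → S ⊆ Finset.range n →
    (∀ x ∈ S, ∀ y ∈ S, (∀ a ∈ A, x ∈ nbr a ↔ y ∈ nbr a) → x = y) → (S.card : ℝ) ≤ c * k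

/-- Merge the blocks whose representatives are twins with respect to a set that contains
one vertex for every trace on the set marked in bank `3`. -/
def mergeTwins : Prog := .seq partition (.seq represent (.seq partition merge))

/-- `FewTraces` is used twice: for the set `B` of vertices with distinct traces on the sample, and
for the new representatives, which have distinct traces on `B`. -/
theorem mergeTwins_spec {σ : Store} {c : ℝ} {k : ℕ} (hin : HasInput n nbr σ)
    (hG : IsGraph n nbr) (hc : 0 ≤ c) (hF : FewTraces n nbr c)
    (hw : n + ∑ u ∈ Finset.range n, (nbr u).length + 1 < 2 ^ w)
    (hB : Blocks n (σ.mem 10) (σ.mem 11) (σ.mem 12)) (hk : 1 ≤ k)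
    (hA : ((Finset.range n).filter fun a => σ.mem 3 a ≠ 0).card ≤ k) :
    Terminates w mergeTwins (68 * n + 28 * (∑ u ∈ Finset.range n, (nbr u).length) + 61) σ (fun τ =>
      (∃ cl, Merged n cl (σ.mem 10) (σ.mem 11) (τ.mem 10) (τ.mem 11) (τ.mem 12)) ∧
      ((reps n (τ.mem 10)).card : ℝ) ≤ c * (c * k) ∧
      ∀ v < n, ∃ v' < n, (∀ a < n, σ.mem 3 a ≠ 0 → (v ∈ nbr a ↔ v' ∈ nbr a)) ∧
        ∀ x < n, τ.mem 10 x ∈ nbr v' ↔ σ.mem 10 x ∈ nbr v') := by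
  set N := ∑ u ∈ Finset.range n, (nbr u).length
  unfold mergeTwins
  refine Terminates.mono (.seq_frame (partition_spec hin hG.nodup hG.lt hw) fun τ hτ hUτ =>
    .seq_frame (represent_spec (hin.of_unchanged hUτ rfl rfl rfl).size (by omega))
    fun υ hυ hUυ => .seq_frame (partition_spec ((hin.of_unchanged hUτ rfl rfl rfl).of_unchanged
      hUυ rfl rfl rfl) hG.nodup hG.lt hw) fun θ hθ hUθ => Terminates.mono (merge_spec
      (((hin.of_unchanged hUτ rfl rfl rfl).of_unchanged hUυ rfl rfl rfl).of_unchanged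
      hUθ rfl rfl rfl).size (by omega) ?_) le_rfl ?_) (by omega) (fun _ h => h)
  · rw [hUθ.mem 10 rfl, hUυ.mem 10 rfl, hUτ.mem 10 rfl, hUθ.mem 11 rfl, hUυ.mem 11 rfl,
      hUτ.mem 11 rfl, hUθ.mem 12 rfl, hUυ.mem 12 rfl, hUτ.mem 12 rfl]
    exact hB
  · intro φ hφ
    rw [hUθ.mem 10 rfl, hUυ.mem 10 rfl, hUτ.mem 10 rfl, hUθ.mem 11 rfl, hUυ.mem 11 rfl,
      hUτ.mem 11 rfl] at hφ
    obtain ⟨hυ1, hυ2⟩ := hυ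
    have hB' := hφ.blocks hB
    set cl := θ.mem 5 with hcl
    have hmem : ∀ b < n, υ.mem 3 b ≠ 0 → ∀ x < n,
        φ.mem 10 x ∈ nbr b ↔ σ.mem 10 x ∈ nbr b := by
      intro b hb hb' x hx
      obtain ⟨h1, h2, h3⟩ := hφ.rep x hx
      exact (hθ _ h1 _ (hB.lt x hx)).1 h3 b hb hb'
    refine ⟨⟨cl, hφ⟩, ?_, ?_⟩
    · set B := (Finset.range n).filter fun b => υ.mem 3 b ≠ 0 with hBdef
      have hBcard : (B.card : ℝ) ≤ c * k := by
        refine hF k _ B hk hA (Finset.filter_subset _ _) (Finset.filter_subset _ _) ?_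
        intro x hx y hy hxy
        simp only [hBdef, Finset.mem_filter, Finset.mem_range] at hx hy
        refine hυ2 x hx.1 y hy.1 hx.2 hy.2 ((hτ x hx.1 y hy.1).2 fun v hv hv' => hxy v ?_)
        exact Finset.mem_filter.2 ⟨Finset.mem_range.2 hv, hv'⟩
      rcases Finset.eq_empty_or_nonempty (reps n (φ.mem 10)) with hR | ⟨r, hr⟩
      · rw [hR]
        simp only [Finset.card_empty, Nat.cast_zero]
        positivity
      · have hrn : r < n := Finset.mem_range.1 (Finset.mem_filter.1 hr).1
        have hB1 : 1 ≤ B.card := by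
          obtain ⟨b, hb, hb', -⟩ := hυ1 r hrn
          exact Finset.card_pos.2 ⟨b, Finset.mem_filter.2 ⟨Finset.mem_range.2 hb, hb'⟩⟩
        refine (hF B.card B (reps n (φ.mem 10)) hB1 le_rfl (Finset.filter_subset _ _)
          (Finset.filter_subset _ _) ?_).trans (mul_le_mul_of_nonneg_left hBcard hc)
        intro x hx y hy hxy
        simp only [reps, Finset.mem_filter, Finset.mem_range] at hx hy
        -- New representatives are old ones, so their own labels decide whether their blocks were
        -- merged.
        have hfix : ∀ x < n, φ.mem 10 x = x → σ.mem 10 x = x := by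
          intro x hx hxx
          have := (hφ.rep x hx).2.1
          rwa [hxx] at this
        have hcl : cl x = cl y := (hθ x hx.1 y hy.1).2 fun v hv hv' =>
          hxy v (Finset.mem_filter.2 ⟨Finset.mem_range.2 hv, hv'⟩)
        rw [← hx.2, ← hy.2]
        exact hφ.eq x hx.1 y hy.1 (by rw [hfix x hx.1 hx.2, hfix y hy.1 hy.2, hcl])
    · intro v hv
      obtain ⟨v', hv', hm, hcl'⟩ := hυ1 v hv
      refine ⟨v', hv', fun a ha ha' => ?_, hmem v' hv' hm⟩
      exact ((hτ v' hv' v hv).1 hcl' a ha ha').symm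

/-- Sample vertices among the representatives, and merge blocks accordingly. -/
def round : Prog := .seq collect (.seq draw mergeTwins)

/-- A bound on the probability that the sample of a round misses one of the sets of more than `δ`
representatives that distinguish two vertices. -/
noncomputable def roundError (n : ℕ) (c δ : ℝ) : ENNReal :=
  ENNReal.ofReal ((n : ℝ) ^ 2 * Real.exp (-(δ / (2 * c ^ 2))))

/-- The continuation has to halt in time even after a bad sample, hence the bound `1` without
conditions; the bound `b` is needed only if the budget is passed on. -/
theorem round_safe {S : Set Store} {σ : Store} {l : List Prog} {s k : ℕ} {c δ β : ℝ}
    {b : ENNReal} (hin : HasInput n nbr σ) (hG : IsGraph n nbr) (hc : 1 ≤ c)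
    (hF : FewTraces n nbr c)
    (hw : n + ∑ u ∈ Finset.range n, (nbr u).length + 1 < 2 ^ w) (hkw : k < 2 ^ w)
    (hB : Blocks n (σ.mem 10) (σ.mem 11) (σ.mem 12)) (hn : 0 < n) (hk : 1 ≤ k)
    (hk3 : σ.reg 3 = k) (hδ : 0 ≤ δ) (hR : ((reps n (σ.mem 10)).card : ℝ) ≤ 2 * c ^ 2 * k)
    (h : ∀ τ, HasInput n nbr τ → Blocks n (τ.mem 10) (τ.mem 11) (τ.mem 12) →
      ((reps n (τ.mem 10)).card : ℝ) ≤ c ^ 2 * k → τ.reg 3 = k →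
      (Safe w S s 1 ⟨l, τ⟩) ∧ ((Budget n nbr (σ.mem 10) (σ.mem 11) β →
        Budget n nbr (τ.mem 10) (τ.mem 11) (β + 2 * δ)) → Safe w S s b ⟨l, τ⟩)) :
    Safe w S (s + 78 * n + 28 * (∑ u ∈ Finset.range n, (nbr u).length) + 6 * k + 71)
      (b + roundError n c δ) ⟨round :: l, σ⟩ := by
  set N := ∑ u ∈ Finset.range n, (nbr u).length
  have e : s + 78 * n + 28 * N + 6 * k + 71 = ((n * 10 + 5) + ((((68 * n + 28 * N + 61) + s) +
      6 * k + 3) + 1)) + 1 := by ring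
  rw [e]
  refine Safe.of_step_pure rfl ((collect_spec hin.size (by omega)).frame.safe
    fun τ ⟨⟨hτ1, hτ2, hτ3, hτ4⟩, hUτ⟩ => ?_)
  refine Safe.of_step_pure (D := ⟨draw :: mergeTwins :: l, τ⟩) rfl ?_
  set r := τ.reg 4 with hr
  set rho := σ.mem 10 with hrho
  have hrcard : (reps n rho).card = r := by
    rw [← Finset.card_range r]
    refine (Finset.card_bij (fun i _ => τ.mem 4 i) ?_ ?_ ?_).symm
    · intro i hi
      have := hτ2 i (Finset.mem_range.1 hi)
      exact Finset.mem_filter.2 ⟨Finset.mem_range.2 this.1, this.2⟩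
    · intro i hi j hj
      exact hτ4 i (Finset.mem_range.1 hi) j (Finset.mem_range.1 hj)
    · intro x hx
      have := Finset.mem_filter.1 hx
      obtain ⟨i, hi, hix⟩ := hτ3 x (Finset.mem_range.1 this.1) this.2
      exact ⟨i, Finset.mem_range.2 hi, hix⟩
  have hr0 : 0 < r := by
    rw [← hrcard]
    exact Finset.card_pos.2 ⟨_, hB.rho_mem_reps hn⟩
  -- The sample consists of indices into the list of representatives, so distinguishing sets are
  -- pulled back to indices.
  let idx : ℕ × ℕ → Finset ℕ := fun p =>
    (Finset.range r).filter fun i => τ.mem 4 i ∈ distinguishing n nbr rho p.1 p.2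
  have hidx : ∀ p, (idx p).card = (distinguishing n nbr rho p.1 p.2).card := by
    intro p
    refine Finset.card_bij (fun i _ => τ.mem 4 i) ?_ ?_ ?_
    · intro i hi
      exact (Finset.mem_filter.1 hi).2
    · intro i hi j hj
      exact hτ4 i (Finset.mem_range.1 (Finset.mem_filter.1 hi).1) j
        (Finset.mem_range.1 (Finset.mem_filter.1 hj).1)
    · intro x hx
      have := Finset.mem_filter.1 (Finset.mem_filter.1 hx).1
      obtain ⟨i, hi, hix⟩ := hτ3 x (Finset.mem_range.1 this.1) this.2
      exact ⟨i, Finset.mem_filter.2 ⟨Finset.mem_range.2 hi, by rwa [hix]⟩, hix⟩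
  let P : Finset (ℕ × ℕ) := (Finset.range n ×ˢ Finset.range n).filter fun p => δ ≤ (idx p).card
  let F : List ℕ → ENNReal := fun ω => ⨆ (_ : ∃ p ∈ P, ∀ i ∈ ω, i ∉ idx p), 1
  have hPcard : P.card ≤ n ^ 2 := by
    refine (Finset.card_filter_le _ _).trans_eq ?_
    rw [Finset.card_product, Finset.card_range, sq]
  have hbound : avg r k F ≤ roundError n c δ := by
    refine (avg_exists_avoid_le hr0 P idx (fun p _ => Finset.filter_subset _ _) k
      fun p hp => (Finset.mem_filter.1 hp).2).trans (ENNReal.ofReal_le_ofReal ?_)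
    have h1 : (P.card : ℝ) ≤ (n : ℝ) ^ 2 := by exact_mod_cast hPcard
    have hr' : (0 : ℝ) < r := by exact_mod_cast hr0
    rw [hrcard] at hR
    -- The number `r` of blocks is at most `2 * c ^ 2 * k`, so the error does not depend on the
    -- sample size.
    have h2 : δ / (2 * c ^ 2) ≤ δ * k / r := by
      rw [div_le_div_iff₀ (by positivity) hr']
      nlinarith
    exact mul_le_mul h1 (Real.exp_le_exp.2 (by linarith)) (Real.exp_pos _).le (by positivity)
  have hinτ : HasInput n nbr τ := hin.of_unchanged hUτ rfl rfl rfl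
  refine (draw_safe (F := fun ω => b + F ω) ((hUτ.reg 3 rfl).trans hk3) hr.symm hr0 hkw (by omega)
    fun ω hω hω' υ hUυ hυ => ?_).mono le_rfl ?_
  · have hmark : ∀ a < n, υ.mem 3 a ≠ 0 ↔ ∃ i ∈ ω, τ.mem 4 i = a := by
      intro a ha
      rw [hυ a, hτ1 a ha]
      simp
    have hA : ((Finset.range n).filter fun a => υ.mem 3 a ≠ 0).card ≤ k := by
      rw [← hω, ← List.length_map (as := ω) (τ.mem 4)]
      refine le_trans (Finset.card_le_card fun a ha => ?_) (List.toFinset_card_le _)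
      simp only [Finset.mem_filter, Finset.mem_range] at ha
      simpa using (hmark a ha.1).1 ha.2
    have e10 : υ.mem 10 = rho := by rw [hUυ.mem 10 rfl, hUτ.mem 10 rfl]
    have e11 : υ.mem 11 = σ.mem 11 := by rw [hUυ.mem 11 rfl, hUτ.mem 11 rfl]
    have e12 : υ.mem 12 = σ.mem 12 := by rw [hUυ.mem 12 rfl, hUτ.mem 12 rfl]
    have hinυ : HasInput n nbr υ := hinτ.of_unchanged hUυ rfl rfl rfl
    refine (mergeTwins_spec hinυ hG (by linarith) hF hw (by rwa [e10, e11, e12]) hk hA).frame.safe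
      fun θ hθ => ?_
    obtain ⟨⟨⟨cl, hm⟩, hcard, hrep⟩, hUθ⟩ := hθ
    rw [e10, e11] at hm
    have := h θ (hinυ.of_unchanged hUθ rfl rfl rfl) (hm.blocks hB) (by linarith)
      (by rw [hUθ.reg 3 rfl, hUυ.reg 3 rfl, hUτ.reg 3 rfl, hk3])
    -- On a bad sample `F ω = 1` pays for everything. On a good one, a vertex `v'` with the trace of
    -- `v` cannot be distinguished from it by `δ` or more representatives, since one of them would
    -- have been sampled.
    by_cases hbad : ∃ p ∈ P, ∀ i ∈ ω, i ∉ idx p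
    · exact this.1.mono le_rfl (le_add_self.trans' (le_iSup_of_le hbad le_rfl))
    · refine (this.2 fun hbud => hbud.merge hB hm fun v hv => ?_).mono le_rfl le_self_add
      obtain ⟨v', hv', htr, hx⟩ := hrep v hv
      refine ⟨v', hv', ?_, fun x hx' => by rw [hx x hx', e10]⟩
      by_contra hlt
      push Not at hlt
      refine hbad ⟨(v, v'), Finset.mem_filter.2 ⟨by simp [hv, hv'], by rw [hidx]; exact hlt.le⟩, ?_⟩
      intro i hi hmem
      have hmem' := Finset.mem_filter.1 (Finset.mem_filter.1 hmem).2
      have hin : τ.mem 4 i < n := (hτ2 i (hω' i hi)).1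
      refine hmem'.2 ?_
      have := htr _ hin ((hmark _ hin).2 ⟨i, hi, rfl⟩)
      exact ⟨fun h1 => hG.symm _ hv' _ hin (this.1 (hG.symm _ hin _ hv h1)),
        fun h1 => hG.symm _ hv _ hin (this.2 (hG.symm _ hin _ hv' h1))⟩
  · rw [avg_add, avg_const hr0]
    gcongr

end WordRAM

namespace WordRAM

variable {w n : ℕ} {nbr : ℕ → List ℕ}

/-! ### Iterating the rounds. -/

theorem Safe.one {S : Set Store} {t : ℕ} {b : ENNReal} {C : Config} (h : Safe w S t b C) :
    Safe w S t 1 C := by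
  refine ⟨h.1, ?_⟩
  rw [PMF.toOuterMeasure_apply, ← PMF.tsum_coe (run w t C)]
  exact ENNReal.tsum_le_tsum fun D => Set.indicator_le_self _ _ D

/-- Perform rounds while halving the sample size in register `3`. -/
def rounds : Prog := .loop (.reg 3) (.seq round (.assign 3 (.bin .div (.reg 3) (.lit 2))))

/-- Here `j` rounds remain, and the next sample size is `2 ^ j / 2`, which is `0` exactly when `j =
0`. The invariant of at most `c ^ 2 * 2 ^ j` blocks is restored by each round. -/
theorem rounds_safe {S : Set Store} {l : List Prog} {s : ℕ} {c δ β' : ℝ}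
    (hG : IsGraph n nbr) (hc : 1 ≤ c) (hF : FewTraces n nbr c)
    (hw : n + ∑ u ∈ Finset.range n, (nbr u).length + 1 < 2 ^ w) (hδ : 0 ≤ δ)
    (h : ∀ τ, HasInput n nbr τ → Blocks n (τ.mem 10) (τ.mem 11) (τ.mem 12) →
      ((reps n (τ.mem 10)).card : ℝ) ≤ c ^ 2 →
      Safe w S s 1 ⟨l, τ⟩ ∧ (Budget n nbr (τ.mem 10) (τ.mem 11) β' → Safe w S s 0 ⟨l, τ⟩))
    (j : ℕ) : ∀ (σ : Store) (β : ℝ), 2 ^ j ≤ max 1 (2 * n) → HasInput n nbr σ →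
      Blocks n (σ.mem 10) (σ.mem 11) (σ.mem 12) → σ.reg 3 = 2 ^ j / 2 →
      ((reps n (σ.mem 10)).card : ℝ) ≤ c ^ 2 * 2 ^ j → β + 2 * δ * j = β' →
      Safe w S (s + 1 + j * (84 * n + 28 * (∑ u ∈ Finset.range n, (nbr u).length) + 74)) 1
        ⟨rounds :: l, σ⟩ ∧
      (Budget n nbr (σ.mem 10) (σ.mem 11) β →
        Safe w S (s + 1 + j * (84 * n + 28 * (∑ u ∈ Finset.range n, (nbr u).length) + 74))
          (j * roundError n c δ) ⟨rounds :: l, σ⟩) := by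
  set N := ∑ u ∈ Finset.range n, (nbr u).length
  induction j with
  | zero =>
    intro σ β _ hin hB h3 hR hβ
    have hstep : step w ⟨rounds :: l, σ⟩ = PMF.pure ⟨l, σ⟩ := by
      rw [rounds, step, if_neg]
      simp [Exp.eval, h3]
    have := h σ hin hB (by simpa using hR)
    refine ⟨(Safe.of_step_pure hstep this.1).mono (by omega) le_rfl, fun hbud => ?_⟩
    refine (Safe.of_step_pure hstep (this.2 ?_)).mono (by omega) (by simp)
    have : β = β' := by simpa using hβ
    rwa [← this]
  | succ j ih =>
    intro σ β hj hin hB h3 hR hβ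
    have h3' : σ.reg 3 = 2 ^ j := by rw [h3, pow_succ]; simp
    have hpos : 0 < 2 ^ j := by positivity
    have hpow : (2 : ℕ) ^ (j + 1) = 2 * 2 ^ j := by ring
    -- Samples have at most `n` elements, so that drawing them takes linear time.
    have hjn : 2 ^ j ≤ n := by omega
    have hn : 0 < n := by omega
    have h2w : 2 % 2 ^ w = 2 := Nat.mod_eq_of_lt (by omega)
    have hstep : step w ⟨rounds :: l, σ⟩ = PMF.pure
        ⟨.seq round (.assign 3 (.bin .div (.reg 3) (.lit 2))) :: rounds :: l, σ⟩ := by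
      rw [rounds, step, if_pos]
      simp [Exp.eval, h3']
    -- Used with `b = 1` for halting alone, and with `b = j * roundError n c δ` when the budget is
    -- available.
    have key : ∀ b : ENNReal, (∀ τ : Store, Safe w S
          (s + 1 + j * (84 * n + 28 * N + 74)) 1 ⟨rounds :: l, τ⟩ ∧
          (Budget n nbr (τ.mem 10) (τ.mem 11) (β + 2 * δ) → Safe w S
          (s + 1 + j * (84 * n + 28 * N + 74)) (j * roundError n c δ) ⟨rounds :: l, τ⟩) →
          (Budget n nbr (σ.mem 10) (σ.mem 11) β →
            Budget n nbr (τ.mem 10) (τ.mem 11) (β + 2 * δ)) →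
          Safe w S (s + 1 + j * (84 * n + 28 * N + 74)) b ⟨rounds :: l, τ⟩) →
        Safe w S (s + 1 + (j + 1) * (84 * n + 28 * N + 74)) (b + roundError n c δ)
          ⟨rounds :: l, σ⟩ := by
      intro b hb
      refine (Safe.of_step_pure hstep (Safe.of_step_pure rfl (round_safe (k := 2 ^ j)
        (s := s + 1 + j * (84 * n + 28 * N + 74) + 1) hin hG hc hF hw (by omega)
        hB hn hpos h3' hδ (β := β) (b := b) ?_ fun τ hinτ hBτ hRτ h3τ => ?_))).mono ?_ le_rfl
      · refine hR.trans_eq ?_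
        push_cast
        ring
      · have e : Exp.eval w τ (.bin .div (.reg 3) (.lit 2)) = 2 ^ j / 2 := by
          simp [Exp.eval, Op.eval, h3τ, h2w]
        have hstep' : step w ⟨.assign 3 (.bin .div (.reg 3) (.lit 2)) :: rounds :: l, τ⟩ =
            PMF.pure ⟨rounds :: l, τ.setReg 3 (2 ^ j / 2)⟩ := by
          rw [step, e]
        have hih := ih (τ.setReg 3 (2 ^ j / 2)) (β + 2 * δ) (by omega) (hinτ.setReg (by norm_num))
          hBτ (by simp [setReg_reg]) (by simpa using hRτ) (by rw [← hβ]; push_cast; ring)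
        exact ⟨Safe.of_step_pure hstep' hih.1,
          fun hbud => Safe.of_step_pure hstep' (hb _ hih hbud)⟩
      · change _ + 78 * n + 28 * N + 6 * 2 ^ j + 71 + 1 + 1 ≤ _
        nlinarith
    refine ⟨(key 1 fun τ hτ _ => hτ.1).one, fun hbud => ?_⟩
    refine (key (j * roundError n c δ) fun τ hτ h => hτ.2 (h hbud)).mono le_rfl (le_of_eq ?_)
    push_cast
    ring

/-! ### Initialization and output -/

/-- Put every vertex into a block of its own. -/
def init : Prog :=
  .seq (.assign 3 (.lit 1)) (.seq (.loop (.bin .lt (.reg 3) (.reg 0))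
      (.assign 3 (.bin .add (.reg 3) (.reg 3))))
    (.seq (.assign 3 (.bin .div (.reg 3) (.lit 2)))
      (forLoop 5 (.lit 0) (.reg 0) (.seq (.store 10 (.reg 5) (.reg 5))
        (.store 12 (.reg 5) (.lit 1))))))

theorem double_spec (hw : 2 * n < 2 ^ w) (hw2 : 2 < 2 ^ w) {i : ℕ}
    (hi : i ≤ Nat.clog 2 n) : ∀ σ : Store, σ.reg 0 = n → σ.reg 3 = 2 ^ i →
    Terminates w (.loop (.bin .lt (.reg 3) (.reg 0)) (.assign 3 (.bin .add (.reg 3) (.reg 3))))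
      (2 * (Nat.clog 2 n - i) + 1) σ (fun τ => τ.reg 3 = 2 ^ Nat.clog 2 n) := by
  induction hi using Nat.decreasingInduction with
  | self =>
    intro σ h0 h3
    have : ¬ 2 ^ Nat.clog 2 n < n := not_lt.2 (Nat.le_pow_clog (by norm_num) n)
    refine Terminates.mono (.loop_done (Q := fun τ => τ.reg 3 = 2 ^ Nat.clog 2 n) ?_ h3) (by omega)
      fun _ h => h
    simp [Exp.eval, Op.eval, h0, h3, this]
  | of_succ i hi ih =>
    intro σ h0 h3
    have hlt : 2 ^ i < n := (Nat.lt_clog_iff_pow_lt (by norm_num)).1 hi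
    have h1w : 1 % 2 ^ w = 1 := Nat.mod_eq_of_lt (by omega)
    refine Terminates.mono (.loop_step ?_ (.assign (Q := fun τ => τ.reg 0 = n ∧
      τ.reg 3 = 2 ^ (i + 1)) ?_) fun τ hτ => ih τ hτ.1 hτ.2) (by omega) fun _ h => h
    · simp [Exp.eval, Op.eval, h0, h3, hlt, h1w]
    · refine ⟨by simpa [setReg_reg] using h0, ?_⟩
      have : (2 ^ i + 2 ^ i) % 2 ^ w = 2 ^ i + 2 ^ i := Nat.mod_eq_of_lt (by omega)
      simp [setReg_reg, Exp.eval, Op.eval, h3, this, pow_succ]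
      ring

/-- The offsets in bank `11` need no initialization, because these cells of the input are `0`. -/
theorem init_spec {σ : Store} (hn : σ.reg 0 = n) (hw : 2 * n < 2 ^ w) (hw2 : 2 < 2 ^ w) :
    Terminates w init (2 * Nat.clog 2 n + 6 * n + 9) σ (fun τ =>
      τ.reg 3 = 2 ^ Nat.clog 2 n / 2 ∧ (∀ x < n, τ.mem 10 x = x) ∧ ∀ x < n, τ.mem 12 x = 1) := by
  have h1w : 1 % 2 ^ w = 1 := Nat.mod_eq_of_lt (by omega)
  unfold init
  refine Terminates.mono (.seq_frame (.assign (Q := fun τ => τ.reg 3 = 1) ?_) fun τ hτ hUτ =>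
    .seq_frame (double_spec hw hw2 (i := 0) (Nat.zero_le _) τ (by rw [hUτ.reg 0 rfl, hn])
      (by simpa using hτ)) fun υ hυ hUυ => .seq_frame (.assign (Q := fun τ => τ.reg 3 =
      2 ^ Nat.clog 2 n / 2) ?_) fun θ hθ hUθ => Terminates.mono (Prog.Straight.forLoop (n := n)
      (by simp [Prog.Straight]) (fun j τ => (∀ x < j, τ.mem 10 x = x) ∧ ∀ x < j, τ.mem 12 x = 1)
      (by rw [hUθ.reg 0 rfl, hUυ.reg 0 rfl, hUτ.reg 0 rfl, hn]) (by omega) rfl rfl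
      (by simp) ?_).frame le_rfl ?_) ?_ (fun _ h => h)
  · simp [setReg_reg, Exp.eval, h1w]
  · simp [setReg_reg, Exp.eval, Op.eval, hυ, Nat.mod_eq_of_lt hw2]
  · rintro j φ hj hU hφj ⟨I1, I2⟩
    simp only [Prog.exec, Exp.eval, setReg_mem, setMem_mem, setMem_reg, hφj, h1w]
    constructor
    · intro x hx
      by_cases h : x = j
      · simp [h]
      · simpa [h] using I1 x (by omega)
    · intro x hx
      by_cases h : x = j
      · simp [h]
      · simpa [h] using I2 x (by omega)
  · rintro φ ⟨⟨I1, I2⟩, hU⟩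
    exact ⟨by rw [hU.reg 3 rfl, hθ], I1, I2⟩
  · simp [Prog.cost]
    omega

theorem Blocks.singletons {rho off sz : ℕ → ℕ} (hrho : ∀ x < n, rho x = x)
    (hoff : ∀ x < n, off x = 0) (hsz : ∀ x < n, sz x = 1) : Blocks n rho off sz := by
  have hcard : ∀ x < n, ((Finset.range n).filter fun z => rho z = x).card = 1 := by
    intro x hx
    rw [Finset.card_eq_one]
    refine ⟨x, ?_⟩
    ext z
    simp only [Finset.mem_filter, Finset.mem_range, Finset.mem_singleton]
    constructor
    · rintro ⟨h1, h2⟩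
      rw [← h2, hrho z h1]
    · rintro rfl
      exact ⟨hx, hrho z hx⟩
  refine ⟨fun x hx => by rwa [hrho x hx], fun x hx => by rw [hrho x hx, hrho x hx],
    fun x hx _ => by rw [hsz x hx, hcard x hx], fun x hx => ?_, fun x hx y hy h _ => ?_⟩
  · rw [hoff x hx, hrho x hx, hcard x hx]
    exact Nat.one_pos
  · rwa [hrho x hx, hrho y hy] at h

/-- Merge all blocks, and write the resulting order to bank `2`. -/
def finish : Prog :=
  .seq (forLoop 5 (.lit 0) (.reg 0) (.store 5 (.reg 5) (.lit 0))) (.seq merge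
    (forLoop 5 (.lit 0) (.reg 0) (.store 2 (.read 11 (.reg 5)) (.reg 5))))

/-- With equal labels everywhere a single block remains, whose offsets are a numbering of all
vertices that keeps the previous blocks together. -/
theorem finish_spec {σ : Store} (hn : σ.reg 0 = n) (hw : n + 1 < 2 ^ w)
    (hB : Blocks n (σ.mem 10) (σ.mem 11) (σ.mem 12)) :
    Terminates w finish (32 * n + 19) σ (fun τ => ∃ pos : ℕ → ℕ,
      (∀ x < n, pos x < n ∧ τ.mem 2 (pos x) = x) ∧ Extends n (σ.mem 10) (σ.mem 11) pos) := by
  have key : ∀ cl rho' off' sz' : ℕ → ℕ, (∀ x < n, cl x = 0) →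
      Merged n cl (σ.mem 10) (σ.mem 11) rho' off' sz' →
      (∀ x < n, off' x < n) ∧ Extends n (σ.mem 10) (σ.mem 11) off' := by
    intro cl rho' off' sz' hcl hm
    have hB' := hm.blocks hB
    have hinj : ∀ x < n, ∀ y < n, off' x = off' y → x = y := fun x hx y hy h =>
      hB'.inj x hx y hy (hm.eq x hx y hy (by rw [hcl _ (hB.lt x hx), hcl _ (hB.lt y hy)])) h
    exact ⟨fun x hx => (hB'.off_lt x hx).trans_le ((Finset.card_filter_le _ _).trans_eq
      (Finset.card_range n)), hm.extends hB ⟨⟨fun _ => 0, by simp⟩, hinj⟩⟩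
  unfold finish
  refine Terminates.mono (.seq_frame (Prog.Straight.forLoop (n := n) (by trivial)
    (fun j τ => ∀ x < j, τ.mem 5 x = 0) hn (by omega) rfl rfl (by simp) ?_) fun τ hτ hUτ =>
    .seq_frame (merge_spec (by rw [hUτ.reg 0 rfl, hn]) hw ?_) fun υ hυ hUυ =>
    Terminates.mono (Prog.Straight.forLoop (n := n) (by trivial) (fun j θ => ∀ x < j,
      θ.mem 2 (υ.mem 11 x) = x) (by rw [hUυ.reg 0 rfl, hUτ.reg 0 rfl, hn]) (by omega) rfl rfl
      (by simp) ?_) le_rfl ?_) ?_ (fun _ h => h)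
  · intro j τ hj hU hτj hI x hx
    simp only [Prog.exec, Exp.eval, setReg_mem, setMem_mem, hτj, Nat.zero_mod]
    by_cases h : x = j
    · simp [h]
    · simpa [h] using hI x (by omega)
  · rw [hUτ.mem 10 rfl, hUτ.mem 11 rfl, hUτ.mem 12 rfl]
    exact hB
  · intro j θ hj hU hθj hI x hx
    have e11 : θ.mem 11 = υ.mem 11 := hU.mem 11 rfl
    rw [hUτ.mem 10 rfl, hUτ.mem 11 rfl] at hυ
    have hinj := (key _ _ _ _ hτ hυ).2.inj
    simp only [Prog.exec, Exp.eval, setReg_mem, setMem_mem, hθj, e11, true_and]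
    split_ifs with h
    · exact (hinj x (by omega) j hj h).symm
    · exact hI x (by
        have : x ≠ j := by rintro rfl; exact h rfl
        omega)
  · intro θ hθ
    rw [hUτ.mem 10 rfl, hUτ.mem 11 rfl] at hυ
    obtain ⟨h1, h2⟩ := key _ _ _ _ hτ hυ
    exact ⟨υ.mem 11, fun x hx => ⟨h1 x hx, hθ x hx⟩, h2⟩
  · simp [Prog.cost]
    omega

/-- The algorithm. -/
def welzlOrder : Prog := .seq init (.seq rounds finish)

theorem welzlOrder_safe {σ : Store} {c δ : ℝ} (hin : HasInput n nbr σ) (hG : IsGraph n nbr)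
    (h11 : ∀ x, σ.mem 11 x = 0) (hc : 1 ≤ c) (hF : FewTraces n nbr c)
    (hw : 2 * n + ∑ u ∈ Finset.range n, (nbr u).length + 2 < 2 ^ w) (hδ : 0 ≤ δ) :
    Safe w {τ | ∃ pos : ℕ → ℕ, (∀ x < n, pos x < n ∧ τ.mem 2 (pos x) = x) ∧
        ∀ v < n, (blockCrossings n nbr pos id v : ℝ) ≤ 2 * c ^ 2 + 2 * δ * Nat.clog 2 n}
      (38 * n + 31 + Nat.clog 2 n * (84 * n + 28 * (∑ u ∈ Finset.range n, (nbr u).length) + 76))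
      (Nat.clog 2 n * roundError n c δ) ⟨[welzlOrder], σ⟩ := by
  set N := ∑ u ∈ Finset.range n, (nbr u).length
  have h0 := hin.size
  refine (Safe.of_step_pure rfl ((init_spec h0 (by omega) (by omega)).frame.safe
    (s := (32 * n + 19) + 1 + Nat.clog 2 n * (84 * n + 28 * N + 74) + 1)
    fun τ ⟨⟨h3, h10, h12⟩, hUτ⟩ => Safe.of_step_pure rfl
    ((rounds_safe hG hc hF (by omega) hδ (β' := 2 * δ * Nat.clog 2 n) ?_ (Nat.clog 2 n)
    τ 0 ?_ (hin.of_unchanged hUτ rfl rfl rfl) ?_ h3 ?_ (by ring)).2 ?_))).mono ?_ le_rfl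
  · intro υ hinυ hBυ hRυ
    have hfin := finish_spec (w := w) hinυ.size (by omega) hBυ
    refine ⟨hfin.safe (s := 0) fun θ _ => Safe.nil 0 (.inr le_rfl), fun hbud =>
      hfin.safe (s := 0) fun θ hθ => Safe.nil 0 (.inl ?_)⟩
    obtain ⟨pos, hpos, hext⟩ := hθ
    -- The budget is applied with `M = 2 * c ^ 2`, twice the bound on the number of remaining
    -- blocks.
    refine ⟨pos, hpos, hbud pos hext _ fun v hv => ?_⟩
    have := hBυ.blockCrossings_le (nbr := nbr) hext v
    have h : (blockCrossings n nbr pos (υ.mem 10) v : ℝ) ≤ 2 * (reps n (υ.mem 10)).card := by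
      exact_mod_cast this
    linarith
  · rcases Nat.lt_or_ge 1 n with hn | hn
    · have := Nat.pow_pred_clog_lt_self (b := 2) (by norm_num) hn
      have hc1 : 0 < Nat.clog 2 n := Nat.clog_pos (by norm_num) hn
      obtain ⟨j, hj⟩ := Nat.exists_eq_succ_of_ne_zero hc1.ne'
      rw [hj] at this ⊢
      simp only [Nat.pred_succ] at this
      rw [Nat.succ_eq_add_one, pow_succ]
      omega
    · rw [Nat.clog_of_right_le_one hn]
      simp
  · exact .singletons h10 (fun x _ => by rw [hUτ.mem 11 rfl, h11]) h12
  · have h1 : ((reps n (τ.mem 10)).card : ℝ) ≤ n := by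
      exact_mod_cast (Finset.card_filter_le _ _).trans_eq (Finset.card_range n)
    have h2 : (n : ℝ) ≤ 2 ^ Nat.clog 2 n := by exact_mod_cast Nat.le_pow_clog (by norm_num) n
    have h3 : (1 : ℝ) ≤ c ^ 2 := one_le_pow₀ hc
    nlinarith [pow_pos (show (0 : ℝ) < 2 by norm_num) (Nat.clog 2 n)]
  · exact .of_fixed n nbr _ h10
  · have : Nat.clog 2 n * (84 * n + 28 * N + 76) =
        Nat.clog 2 n * (84 * n + 28 * N + 74) + 2 * Nat.clog 2 n := by ring
    omega

end WordRAM

/-! ## Correctness of the algorithm -/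

section Graph

variable {n : ℕ}

/-- The adjacency lists, as lists of numbers. -/
def natLists (adj : Fin n → List (Fin n)) (v : ℕ) : List ℕ :=
  if h : v < n then (adj ⟨v, h⟩).map Fin.val else []

theorem natLists_val (adj : Fin n → List (Fin n)) (v : Fin n) :
    natLists adj v = (adj v).map Fin.val := by
  simp [natLists]

theorem mem_natLists {G : SimpleGraph (Fin n)} {adj : Fin n → List (Fin n)}
    (h : IsAdjacencyList G adj) (u v : Fin n) : (u : ℕ) ∈ natLists adj v ↔ G.Adj v u := by
  rw [natLists_val, List.mem_map_of_injective Fin.val_injective, (h v).2]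

theorem isGraph_natLists {G : SimpleGraph (Fin n)} {adj : Fin n → List (Fin n)}
    (h : IsAdjacencyList G adj) : WordRAM.IsGraph n (natLists adj) := by
  refine ⟨fun v hv => ?_, fun v hv x hx => ?_, fun u hu v hv huv => ?_⟩
  · rw [natLists, dif_pos hv]
    exact (h ⟨v, hv⟩).1.map Fin.val_injective
  · rw [natLists, dif_pos hv, List.mem_map] at hx
    obtain ⟨y, -, rfl⟩ := hx
    exact y.2
  · exact (mem_natLists h ⟨v, hv⟩ ⟨u, hu⟩).2 ((mem_natLists h ⟨u, hu⟩ ⟨v, hv⟩).1 huv).symm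

theorem sum_length_natLists (adj : Fin n → List (Fin n)) {a : ℕ} (ha : a ≤ n) :
    ∑ u : Fin n with u.val < a, (adj u).length =
      ∑ u ∈ Finset.range a, (natLists adj u).length := by
  refine Finset.sum_bij (fun u _ => u.val) ?_ ?_ ?_ ?_
  · intro u hu
    simpa using hu
  · intro u _ v _ h
    exact Fin.ext h
  · intro u hu
    have := Finset.mem_range.1 hu
    exact ⟨⟨u, by omega⟩, by simpa using this, rfl⟩
  · intro u _
    simp [natLists_val]

theorem List.getD_flatten {α : Type*} (d : α) (L : List (List α)) (a j : ℕ) (ha : a < L.length)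
    (hj : j < L[a].length) :
    L.flatten.getD (((L.take a).map List.length).sum + j) d = L[a][j] := by
  induction L generalizing a with
  | nil => simp at ha
  | cons l L ih =>
    cases a with
    | zero =>
      simp only [List.getElem_cons_zero] at hj
      simp [List.getElem?_append_left hj, hj]
    | succ a =>
      simp only [List.length_cons, Nat.add_lt_add_iff_right] at ha
      simp only [List.getElem_cons_succ] at hj ⊢
      rw [List.flatten_cons, List.take_succ_cons, List.map_cons, List.sum_cons,
        List.getD_append_right _ _ _ _ (by omega), add_assoc, Nat.add_sub_cancel_left]
      exact ih a ha hj

theorem hasInput_graphInput (adj : Fin n → List (Fin n)) (c : ℚ) :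
    WordRAM.HasInput n (natLists adj) (graphInput adj c) := by
  refine ⟨rfl, fun a ha => ?_, fun a ha j hj => ?_⟩
  · simp only [graphInput, if_pos ha]
    exact sum_length_natLists adj ha
  · have hL : (List.ofFn adj).flatten.map Fin.val =
        (List.ofFn fun u : Fin n => natLists adj u).flatten := by
      rw [List.map_flatten, List.map_ofFn]
      congr 2
      funext u
      simp [natLists_val]
    have hsum : ∑ u ∈ Finset.range a, (natLists adj u).length =
        (((List.ofFn fun u : Fin n => natLists adj u).take a).map List.length).sum := by
      rw [List.map_take, List.map_ofFn]
      have : List.ofFn (List.length ∘ fun u : Fin n => natLists adj u) =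
          (List.range n).map fun u => (natLists adj u).length := by
        apply List.ext_getElem <;> simp
      rw [this, ← List.map_take, List.take_range, min_eq_left ha.le,
        Finset.sum_range, ← List.sum_ofFn]
      congr 1
      apply List.ext_getElem <;> simp
    simp only [graphInput]
    rw [hL, hsum, List.getD_flatten 0 _ a j (by simpa using ha) (by simpa using hj)]
    simp

theorem fewTraces_natLists {G : SimpleGraph (Fin n)} {adj : Fin n → List (Fin n)}
    (h : IsAdjacencyList G adj) {c : ℚ}
    (hc : ∀ k : ℕ, 1 ≤ k → (neighborhoodComplexity G k : ℚ) ≤ c * k) :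
    WordRAM.FewTraces n (natLists adj) c := by
  classical
  intro k A S hk hA hAn hSn hS
  let A' : Finset (Fin n) := Finset.univ.filter fun a => a.val ∈ A
  have hA' : A'.card ≤ k := by
    refine le_trans ?_ hA
    exact Finset.card_le_card_of_injOn Fin.val (fun a ha => (Finset.mem_filter.1 ha).2)
      Fin.val_injective.injOn
  have h1 : S.card ≤ ((neighborhoodFamily G).image fun X => X ∩ A').card := by
    refine Finset.card_le_card_of_injOn (fun x => if hx : x < n then
      (Finset.univ.filter fun u => G.Adj ⟨x, hx⟩ u) ∩ A' else ∅) (fun x hx => ?_) ?_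
    · have hxn := Finset.mem_range.1 (hSn hx)
      simp only [dif_pos hxn]
      refine Finset.mem_coe.2 (Finset.mem_image_of_mem _ ?_)
      unfold neighborhoodFamily
      refine Finset.mem_image.2 ⟨⟨x, hxn⟩, Finset.mem_univ _, ?_⟩
      congr
    · intro x hx y hy hxy
      have hxn := Finset.mem_range.1 (hSn hx)
      have hyn := Finset.mem_range.1 (hSn hy)
      simp only [dif_pos hxn, dif_pos hyn] at hxy
      refine hS x hx y hy fun a ha => ?_
      have han := Finset.mem_range.1 (hAn ha)
      have h2 := Finset.ext_iff.1 hxy ⟨a, han⟩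
      simp only [Finset.mem_inter, Finset.mem_filter, Finset.mem_univ, true_and, A', ha,
        and_true] at h2
      have hmx := mem_natLists h ⟨x, hxn⟩ ⟨a, han⟩
      have hmy := mem_natLists h ⟨y, hyn⟩ ⟨a, han⟩
      simp only at hmx hmy
      -- `FewTraces` lets the elements of `A` look at `x`, whereas a trace lets `x` look at `A`;
      -- adjacency is symmetric.
      rw [hmx, hmy, G.adj_comm, h2, G.adj_comm]
  have h2 : S.card ≤ neighborhoodComplexity G k := by
    refine h1.trans ?_
    unfold neighborhoodComplexity shatterFunction
    exact Finset.le_sup (f := fun A : Finset (Fin n) =>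
      ((neighborhoodFamily G).image fun X => X ∩ A).card) (by simpa using hA')
  have h3 : (S.card : ℚ) ≤ c * k := le_trans (by exact_mod_cast h2) (hc k hk)
  exact_mod_cast h3

/-- A numbering of the vertices that is written to bank `2` yields an order whose crossings
are the crossings of the numbering. -/
theorem exists_order {G : SimpleGraph (Fin n)} {adj : Fin n → List (Fin n)}
    (h : IsAdjacencyList G adj) {σ : WordRAM.Store} {pos : ℕ → ℕ} {M : ℝ} (hM : 0 ≤ M)
    (hpos : ∀ x < n, pos x < n ∧ σ.mem 2 (pos x) = x)
    (hcr : ∀ v < n, (WordRAM.blockCrossings n (natLists adj) pos id v : ℝ) ≤ M) :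
    ∃ L : LinearOrder (Fin n), OutputsOrder σ L ∧ (graphCrossingNumber L G : ℝ) ≤ M := by
  classical
  let f : Fin n → Fin n := fun x => ⟨pos x, (hpos x x.2).1⟩
  have hf : Function.Injective f := by
    intro x y hxy
    have : pos x = pos y := congrArg Fin.val hxy
    refine Fin.ext ?_
    rw [← (hpos x x.2).2, this, (hpos y y.2).2]
  let e : Fin n ≃ Fin n := Equiv.ofBijective f (Finite.injective_iff_bijective.1 hf)
  let L : LinearOrder (Fin n) := LinearOrder.lift' f hf
  have hlt : ∀ x y : Fin n, L.lt x y ↔ pos x < pos y := fun x y => Iff.rfl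
  have he : ∀ i : Fin n, pos (e.symm i) = i := fun i => congrArg Fin.val (e.apply_symm_apply i)
  refine ⟨L, ⟨e.symm, fun i => ?_, fun i j hij => ?_⟩, ?_⟩
  · have := (hpos (e.symm i) (e.symm i).2).2
    rwa [he i] at this
  · rw [hlt, he, he]
    exact hij
  · have key : ∀ v : Fin n, crossings L (Finset.univ.filter fun u => G.Adj v u) ≤
        WordRAM.blockCrossings n (natLists adj) pos id v := by
      intro v
      unfold crossings WordRAM.blockCrossings
      refine Finset.card_le_card_of_injOn (fun p => (p.1.val, p.2.val)) ?_ ?_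
      · rintro ⟨x, y⟩ hp
        simp only [Finset.coe_filter, Finset.mem_univ, true_and, Set.mem_ofPred_eq,
          Finset.mem_filter] at hp
        obtain ⟨⟨hxy, hno⟩, hne⟩ := hp
        simp only [hlt] at hxy hno
        simp only [Finset.coe_filter, Finset.mem_product, Finset.mem_range, Set.mem_ofPred_eq,
          id, x.2, y.2, true_and, mem_natLists h]
        refine ⟨?_, hne⟩
        -- Otherwise the vertex at position `pos x + 1` would lie strictly between `x` and `y`.
        by_contra hcon
        have hyn := (hpos y y.2).1
        refine hno (e.symm ⟨pos x + 1, by omega⟩) ?_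
        rw [he]
        simp only
        omega
      · rintro ⟨x, y⟩ _ ⟨x', y'⟩ _ hp
        simp only [Prod.mk.injEq] at hp
        rw [Fin.ext hp.1, Fin.ext hp.2]
    have h1 : ∀ X ∈ neighborhoodFamily G, (crossings L X : ℝ) ≤ M := by
      intro X hX
      unfold neighborhoodFamily at hX
      obtain ⟨v, -, rfl⟩ := Finset.mem_image.1 hX
      refine le_trans ?_ (hcr v v.2)
      have := key v
      exact_mod_cast le_trans (le_of_eq (by congr)) this
    have h2 : graphCrossingNumber L G ≤ ⌊M⌋₊ := by
      unfold graphCrossingNumber crossingNumber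
      exact Finset.sup_le fun X hX => Nat.le_floor (h1 X hX)
    exact le_trans (by exact_mod_cast h2) (Nat.floor_le hM)

/-- There are at most `n - 1` consecutive pairs; this settles small `n`. -/
theorem card_crossings_le (adj : Fin n → List (Fin n)) {pos : ℕ → ℕ}
    (hpos : ∀ x < n, pos x < n) (hinj : ∀ x < n, ∀ y < n, pos x = pos y → x = y) (v : ℕ) :
    WordRAM.blockCrossings n (natLists adj) pos id v ≤ n - 1 := by
  unfold WordRAM.blockCrossings
  rw [← Finset.card_range (n - 1)]
  refine Finset.card_le_card_of_injOn (fun p => pos p.1) ?_ ?_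
  · rintro ⟨x, y⟩ hp
    simp only [Finset.coe_filter, Finset.mem_product, Finset.mem_range, Set.mem_ofPred_eq] at hp
    have := hpos y hp.1.2
    simp only [Finset.coe_range, Set.mem_Iio]
    omega
  · rintro ⟨x, y⟩ hp ⟨x', y'⟩ hp' hxx
    simp only [Finset.coe_filter, Finset.mem_product, Finset.mem_range, Set.mem_ofPred_eq]
      at hp hp' hxx
    rw [hinj x hp.1.1 x' hp'.1.1 hxx, hinj y hp.1.2 y' hp'.1.2 (by omega)]

end Graph

/-! ### Numerical estimates -/

section Estimates

variable {n : ℕ}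

theorem clog_two_le (n : ℕ) (hn : 1 ≤ n) : (Nat.clog 2 n : ℝ) ≤ Real.logb 2 n + 1 := by
  have h := Real.natCeil_logb_natCast 2 n
  rw [Nat.cast_ofNat] at h
  rw [← h]
  refine (Nat.ceil_lt_add_one (Real.logb_nonneg (by norm_num) ?_)).le
  exact_mod_cast hn

theorem three_mul_clog_two_le (hn : 16 ≤ n) : 3 * Nat.clog 2 n ≤ n := by
  have h : ∀ q, 5 ≤ q → 3 * q + 2 ≤ 2 ^ q := by
    intro q hq
    induction q, hq using Nat.le_induction with
    | base => norm_num
    | succ q hq ih => rw [pow_succ]; omega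
  have h1 : Nat.clog 2 n ≤ n / 3 := by
    refine Nat.clog_le_of_le_pow ?_
    have := h (n / 3) (by omega)
    omega
  omega

/-- The choice of the parameter of the algorithm's analysis. -/
theorem exists_parameter (n : ℕ) {c : ℝ} (hc : 1 ≤ c) : ∃ δ : ℝ, 0 ≤ δ ∧
    (Nat.clog 2 n : ENNReal) * WordRAM.roundError n c δ ≤ ENNReal.ofReal (1 / 3) ∧
    ∀ x : ℝ, x ≤ (n - 1 : ℕ) → x ≤ 2 * c ^ 2 + 2 * δ * Nat.clog 2 n →
      x ≤ 12 * c ^ 2 * Real.logb 2 n ^ 2 := by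
  have hc2 : 1 ≤ c ^ 2 := one_le_pow₀ hc
  have hmul : ∀ δ, (Nat.clog 2 n : ENNReal) * WordRAM.roundError n c δ =
      ENNReal.ofReal (Nat.clog 2 n * ((n : ℝ) ^ 2 * Real.exp (-(δ / (2 * c ^ 2))))) := by
    intro δ
    rw [WordRAM.roundError, ENNReal.ofReal_mul (p := (Nat.clog 2 n : ℝ)) (by positivity),
      ENNReal.ofReal_natCast]
  have h2 : Real.logb 2 2 = 1 := Real.logb_self_eq_one (by norm_num)
  rcases Nat.lt_or_ge n 16 with hn | hn
  · set q : ℝ := 3 * Nat.clog 2 n * (n : ℝ) ^ 2 + 1 with hq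
    have hq1 : 1 ≤ q := by
      have : (0 : ℝ) ≤ 3 * Nat.clog 2 n * (n : ℝ) ^ 2 := by positivity
      linarith
    refine ⟨2 * c ^ 2 * Real.log q, mul_nonneg (by positivity) (Real.log_nonneg hq1), ?_,
      fun x hx _ => ?_⟩
    · rw [hmul, mul_div_cancel_left₀ _ (by positivity), Real.exp_neg, Real.exp_log (by linarith)]
      refine ENNReal.ofReal_le_ofReal ?_
      rw [← mul_assoc, ← div_eq_mul_inv, div_le_iff₀ (by linarith)]
      linarith
    · refine hx.trans ?_
      have hmono : ∀ a : ℝ, 0 < a → a ≤ n → Real.logb 2 a ≤ Real.logb 2 n := fun a ha han =>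
        Real.logb_le_logb_of_le (by norm_num) ha han
      rcases Nat.lt_or_ge n 2 with h1 | h1
      · have : n - 1 = 0 := by omega
        rw [this]
        simp only [Nat.cast_zero]
        positivity
      rcases Nat.lt_or_ge n 4 with h4 | h4
      · have h3 := hmono 2 (by norm_num) (by exact_mod_cast h1)
        rw [h2] at h3
        have h5 : 1 ≤ Real.logb 2 n ^ 2 := one_le_pow₀ h3
        have h6 : ((n - 1 : ℕ) : ℝ) ≤ 2 := by exact_mod_cast (by omega : n - 1 ≤ 2)
        nlinarith
      · have h3 := hmono 4 (by norm_num) (by exact_mod_cast h4)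
        have h4' : Real.logb 2 4 = 2 := by
          rw [show (4 : ℝ) = 2 ^ (2 : ℕ) by norm_num, Real.logb_pow, h2]
          norm_num
        rw [h4'] at h3
        have h5 : 4 ≤ Real.logb 2 n ^ 2 := by nlinarith
        have h6 : ((n - 1 : ℕ) : ℝ) ≤ 14 := by exact_mod_cast (by omega : n - 1 ≤ 14)
        nlinarith
  · have hn' : (16 : ℝ) ≤ n := by exact_mod_cast hn
    have hn0 : (0 : ℝ) < n := by linarith
    -- The exponential becomes `n ^ (-3)`, so the total error is `Nat.clog 2 n / n`, which is at
    -- most 1/3.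
    refine ⟨2 * c ^ 2 * (3 * Real.log n), mul_nonneg (by positivity) (mul_nonneg (by norm_num)
      (Real.log_nonneg (by linarith))), ?_, fun x _ hx => ?_⟩
    · rw [hmul, mul_div_cancel_left₀ _ (by positivity)]
      refine ENNReal.ofReal_le_ofReal ?_
      have h1 : Real.exp (-(3 * Real.log n)) = ((n : ℝ) ^ 3)⁻¹ := by
        rw [Real.exp_neg, show 3 * Real.log n = Real.log ((n : ℝ) ^ 3) by
          rw [Real.log_pow]; norm_num, Real.exp_log (by positivity)]
      have h3 : (3 : ℝ) * Nat.clog 2 n ≤ n := by exact_mod_cast three_mul_clog_two_le hn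
      rw [h1, show (n : ℝ) ^ 2 * ((n : ℝ) ^ 3)⁻¹ = (n : ℝ)⁻¹ by field_simp, ← div_eq_mul_inv,
        div_le_iff₀ hn0]
      linarith
    · set ℓ := Real.logb 2 n with hℓ
      have hℓ4 : 4 ≤ ℓ := by
        have := Real.logb_le_logb_of_le (b := 2) (by norm_num) (by norm_num) hn'
        have h16 : Real.logb 2 16 = 4 := by
          rw [show (16 : ℝ) = 2 ^ (4 : ℕ) by norm_num, Real.logb_pow, h2]
          norm_num
        rwa [h16] at this
      have hlog : Real.log n = ℓ * Real.log 2 := by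
        rw [hℓ, Real.logb, div_mul_cancel₀]
        exact (Real.log_pos (by norm_num)).ne'
      have hlog2 : Real.log 2 ≤ 0.7 := by
        have := Real.log_two_lt_d9
        norm_num at this ⊢
        linarith
      have hL := clog_two_le n (by omega)
      rw [← hℓ] at hL
      have h1 : Real.log n * Nat.clog 2 n ≤ 0.7 * ℓ * (ℓ + 1) := by
        rw [hlog]
        have h3 : ℓ * Real.log 2 ≤ 0.7 * ℓ := by nlinarith
        exact mul_le_mul h3 hL (by positivity) (by positivity)
      -- The slack between `log 2` and `1` absorbs the rounding of the logarithm and the term `2 * c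
      -- ^ 2`, as `ℓ ≥ 4`.
      have h3 : 2 + 12 * (0.7 * ℓ * (ℓ + 1)) ≤ 12 * ℓ ^ 2 := by nlinarith
      calc x ≤ 2 * c ^ 2 + 2 * (2 * c ^ 2 * (3 * Real.log n)) * Nat.clog 2 n := hx
        _ = c ^ 2 * (2 + 12 * (Real.log n * Nat.clog 2 n)) := by ring
        _ ≤ c ^ 2 * (12 * ℓ ^ 2) := by gcongr; linarith
        _ = 12 * c ^ 2 * ℓ ^ 2 := by ring

/-- The summand `1` on the right covers `n ≤ 1`, where `Real.logb 2 n` is `0`. -/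
theorem time_le (n m : ℕ) :
    ((38 * n + 31 + Nat.clog 2 n * (84 * n + 28 * (2 * m) + 76) : ℕ) : ℝ) ≤
      (300 : ℕ) * (((n : ℝ) + m) * Real.logb 2 n + 1) := by
  rcases Nat.lt_or_ge n 2 with hn | hn
  · rw [Nat.clog_of_right_le_one (by omega)]
    have h1 : (n : ℝ) ≤ 1 := by exact_mod_cast (by omega : n ≤ 1)
    have h2 : Real.logb 2 n = 0 := by
      interval_cases n <;> simp
    rw [h2]
    push_cast
    linarith
  · have hn' : (2 : ℝ) ≤ n := by exact_mod_cast hn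
    have hL := clog_two_le n (by omega)
    have hℓ : 1 ≤ Real.logb 2 n := by
      have := Real.logb_le_logb_of_le (b := 2) (by norm_num) (by norm_num) hn'
      rwa [Real.logb_self_eq_one (by norm_num)] at this
    set ℓ := Real.logb 2 n
    have hm : (0 : ℝ) ≤ m := by positivity
    push_cast
    have h1 : (Nat.clog 2 n : ℝ) * (84 * n + 28 * (2 * m) + 76) ≤
        (2 * ℓ) * (122 * (n + m)) := by
      refine mul_le_mul (by linarith) (by linarith) (by positivity) (by linarith)
    have h2 : (38 * n + 31 : ℝ) ≤ 54 * (n + m) * ℓ := by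
      have : (0 : ℝ) ≤ 54 * (n + m) := by positivity
      nlinarith
    nlinarith [mul_nonneg (add_nonneg (by linarith : (0 : ℝ) ≤ n) hm) (by linarith : (0 : ℝ) ≤ ℓ)]

theorem WordRAM.Safe.two_thirds_le {w : ℕ} {S : Set WordRAM.Store} {t : ℕ}
    {C : WordRAM.Config} (h : WordRAM.Safe w S t (ENNReal.ofReal (1 / 3)) C) :
    (2 / 3 : ENNReal) ≤ (WordRAM.run w t C).toOuterMeasure {D | D.Halted ∧ D.store ∈ S} := by
  set μ := (WordRAM.run w t C).toOuterMeasure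
  set A : Set WordRAM.Config := {D | D.Halted ∧ D.store ∈ S} with hA
  have h1 : μ Set.univ = 1 :=
    (PMF.toOuterMeasure_apply_eq_one_iff _ _).2 (Set.subset_univ _)
  have h2 : μ Set.univ ≤ μ A + μ Aᶜ := by
    rw [← Set.union_compl_self A]
    exact MeasureTheory.measure_union_le A Aᶜ
  have h3 : μ Aᶜ ≤ ENNReal.ofReal (1 / 3) := h.2
  have h4 : (1 : ENNReal) ≤ μ A + ENNReal.ofReal (1 / 3) := by
    rw [← h1]
    exact h2.trans (by gcongr)
  have h5 : (2 / 3 : ENNReal) = ENNReal.ofReal (2 / 3) := by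
    rw [ENNReal.ofReal_div_of_pos (by norm_num)]
    simp
  rw [h5]
  have h6 : ENNReal.ofReal (2 / 3) + ENNReal.ofReal (1 / 3) = 1 := by
    rw [← ENNReal.ofReal_add (by norm_num) (by norm_num)]
    norm_num
  rw [← h6] at h4
  exact (ENNReal.add_le_add_iff_right ENNReal.ofReal_ne_top).1 h4

end Estimates

/-! ### Assembly of the main theorem. -/

theorem theorem4 :
    ∃ (P : WordRAM.Prog) (κ K : ℕ),
      ∀ (n m : ℕ) (G : SimpleGraph (Fin n)) (c : ℚ),
        G.edgeSet.ncard = m → 1 ≤ c →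
        (∀ k : ℕ, 1 ≤ k → (neighborhoodComplexity G k : ℚ) ≤ c * k) →
        ∀ adj : Fin n → List (Fin n), IsAdjacencyList G adj →
        ∀ w : ℕ, κ * Nat.size (n + m + c.num.toNat + c.den) ≤ w →
        ∃ T : ℕ, (T : ℝ) ≤ K * (((n : ℝ) + m) * Real.logb 2 n + 1) ∧
          (∀ C ∈ (WordRAM.run w T ⟨[P], graphInput adj c⟩).support, C.Halted) ∧
          (2 / 3 : ENNReal) ≤ (WordRAM.run w T ⟨[P], graphInput adj c⟩).toOuterMeasure
            {C | C.Halted ∧ ∃ L : LinearOrder (Fin n), OutputsOrder C.store L ∧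
              (graphCrossingNumber L G : ℝ) ≤ 12 * (c : ℝ) ^ 2 * Real.logb 2 n ^ 2} := by
  classical
  refine ⟨WordRAM.welzlOrder, 2, 300, fun n m G c hm hc hπ adj hadj w hw => ?_⟩
  have hc' : (1 : ℝ) ≤ c := by exact_mod_cast hc
  have hN : ∑ u ∈ Finset.range n, (natLists adj u).length = 2 * m := by
    rw [← sum_length_natLists adj le_rfl, ← hm, ← SimpleGraph.coe_edgeFinset,
      Set.ncard_coe_finset, ← G.sum_degrees_eq_twice_card_edges]
    refine Finset.sum_congr (by simp) fun u _ => ?_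
    rw [← List.toFinset_card_of_nodup (hadj u).1, ← SimpleGraph.card_neighborFinset_eq_degree]
    congr 1
    ext v
    simp [(hadj u).2 v]
  -- The factor 2 in the word size gives at least one extra bit, hence room for `2 * (n + m) + 2`.
  have hword : 2 * n + ∑ u ∈ Finset.range n, (natLists adj u).length + 2 < 2 ^ w := by
    rw [hN]
    set s := Nat.size (n + m + c.num.toNat + c.den) with hs
    have h1 : n + m + c.num.toNat + c.den < 2 ^ s := Nat.lt_size_self _
    have h2 : 1 ≤ c.den := c.den_pos
    have h3 : 1 ≤ s := Nat.size_pos.2 (by omega)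
    have h4 : 1 ≤ c.num.toNat := by
      have : 0 < c.num := Rat.num_pos.2 (by linarith)
      omega
    have h5 : 2 ^ (s + 1) ≤ 2 ^ w := Nat.pow_le_pow_right (by norm_num) (by omega)
    rw [pow_succ] at h5
    omega
  obtain ⟨δ, hδ, herr, hbound⟩ := exists_parameter n hc'
  have hsafe := (WordRAM.welzlOrder_safe (hasInput_graphInput adj c) (isGraph_natLists hadj)
    (fun _ => rfl) hc' (fewTraces_natLists hadj hπ) hword hδ).mono le_rfl herr
  rw [hN] at hsafe
  refine ⟨_, time_le n m, hsafe.1, hsafe.two_thirds_le.trans (MeasureTheory.measure_mono ?_)⟩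
  rintro C ⟨hC, pos, hpos, hcr⟩
  refine ⟨hC, exists_order hadj (by positivity) hpos fun v hv => hbound _ ?_ (hcr v hv)⟩
  exact_mod_cast card_crossings_le adj (fun x hx => (hpos x hx).1) (fun x hx y hy hxy => by
    rw [← (hpos x hx).2, hxy, (hpos y hy).2]) v
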